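/- **Conventions.** Let $\mathbb K$ be a good topological ring, i.e. a commutative topological ring whose unit group is dense. Let $R$ be a commutative topological ring, let $V,W$ be topological $R$-modules and let $U\subset V$ be open. Put $U^{[1]}=\{(x,v,s)\in V\times V\times R: x\in U,\ x+sv\in U\}$. A map $f:U\to W$ is of class $C^0_R$ if it is continuous, and of class $C^{m+1}_R$ if there is a map $f^{[1]}:U^{[1]}\to W$ of class $C^m_R$ with $f(x+sv)-f(x)=s\,f^{[1]}(x,v,s)$ on $U^{[1]}$. It is smooth over $R$ if it is $C^m_R$ for all $m$. (If $R$ is good and $W$ is Hausdorff, it suffices to require this identity for invertible $s$, and $f^{[1]}$ is unique.) A smooth manifold over $R$ modelled on $V$ is a topological space with an atlas of charts onto open subsets of $V$ whose transition maps are smooth over $R$. A map between such manifolds is smooth over $R$ if it is continuous and all its expressions in charts of the atlases are smooth over $R$. Let $n\in\mathbb N$, $\mathbf t=(t_1,\dots,t_n)\in\mathbb K^n$ and $A\subset\{1,\dots,n\}$. The vertex ring $\mathbb K_{\mathbf t}^{A;n}$ is the free $\mathbb K$-module with basis $(e_B)_{B\subset A}$, the product topology and the multiplication $e_Be_C=t_{B\cap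 C}\,e_{B\cup C}$, where $t_B=\prod_{i\in B}t_i$. For a topological $\mathbb K$-module $V$ let $V_{\mathbf t}^{A;n}=\bigoplus_{B\subset A}Ve_B$, which is a module over $\mathbb K_{\mathbf t}^{A;n}$ by the same formula. For $U\subset V$ open, $f:U\to W$ smooth over $\mathbb K$ with $W$ Hausdorff, and $t\in\mathbb K$, let $U_t=\{(x,v)\in V^2: x\in U,\ x+tv\in U\}$ and $f_t(x,v)=(f(x),f^{[1]}(x,v,t))$. Applying these constructions successively for the $t_k$ with $k\in A$, in increasing order of $k$ (and writing the pair $(x,y)$ of the $k$-th step as $x+ye_k$, with $e_Be_k=e_{B\cup\{k\}}$), one gets $U_{\mathbf t}^{A;n}\subset V_{\mathbf t}^{A;n}$ and $f_{\mathbf t}^{A;n}:U_{\mathbf t}^{A;n}\to W_{\mathbf t}^{A;n}$. For a smooth Hausdorff manifold $M$ over $\mathbb K$ with a given atlas, $M_{\mathbf t}^{A;n}$ is the space glued from the sets $U_{\mathbf t}^{A;n}$, where $U$ runs through the images of the charts of the atlas, along the maps $\tau_{\mathbf t}^{A;n}$, where $\tau$ runs through the transition maps. **Theorem (scalar extension).**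 Let $M$ and $N$ be smooth Hausdorff manifolds over the good topological ring $\mathbb K$, modelled on topological $\mathbb K$-modules $V$ and $W$, and let $n\in\mathbb N$, $\mathbf t\in\mathbb K^n$, $A\subset\{1,\dots,n\}$. 1. Every chart of the atlas of $M$ induces a chart of $M_{\mathbf t}^{A;n}$ with values in $V_{\mathbf t}^{A;n}$, and with these charts $M_{\mathbf t}^{A;n}$ is a Hausdorff manifold which is smooth over the ring $\mathbb K_{\mathbf t}^{A;n}$. 2. Suppose that any finitely many points of $N$ lie in the (possibly disconnected) domain of one chart of the atlas of $N$, or that $\mathbb K$ is a field with continuous inversion, $W\neq 0$ and the atlas of $N$ is maximal. Then for every map $f:M\to N$ which is smooth over $\mathbb K$ there is exactly one map $f_{\mathbf t}^{A;n}:M_{\mathbf t}^{A;n}\to N_{\mathbf t}^{A;n}$ which is given, in the induced charts, by the maps $\varphi_{\mathbf t}^{A;n}$ for the chart expressions $\varphi$ of $f$, and it is smooth over the ring $\mathbb K_{\mathbf t}^{A;n}$. -/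

import Mathlib

universe u

namespace LieCalculus

section Calculus

variable {K V W : Type u} [CommRing K] [TopologicalSpace K]
  [AddCommGroup V] [Module K V] [TopologicalSpace V]
  [AddCommGroup W] [Module K W] [TopologicalSpace W]

/-- A topological ring is good if its units are dense. -/
def IsGood (K : Type u) [CommRing K] [TopologicalSpace K] : Prop :=
  Dense {a : K | IsUnit a}

/-- The first extended domain `U^[1] = {(x, v, t) | x ∈ U, x + t v ∈ U}`. -/
def extDomain (K : Type u) {V : Type u} [CommRing K] [AddCommGroup V] [Module K V] (U : Set V) :
    Set (V × V × K) :=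
  {p | p.1 ∈ U ∧ p.1 + p.2.2 • p.2.1 ∈ U}

/-- `g` is a difference quotient map of `f` on `U^[1]`: `f (x + t v) - f x = t g (x, v, t)`.
For invertible `t` this says that `g (x, v, t) = (f (x + t v) - f x) / t`. For continuous `g` over
a good ring with Hausdorff `W` it is enough to ask this for invertible `t`,
see `isSlope_of_isUnit`. -/
def IsSlope (K : Type u) {V W : Type u} [CommRing K] [AddCommGroup V] [Module K V]
    [AddCommGroup W] [Module K W] (f : V → W) (U : Set V) (g : V × V × K → W) : Prop :=
  ∀ p ∈ extDomain K U, f (p.1 + p.2.2 • p.2.1) - f p.1 = p.2.2 • g p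

/-- The class `C^m` over `K` for a map `f` on an open subset `U` of `V` (the values of `f` outside
`U` are irrelevant): `C^0` means continuous, and `f` is `C^(m+1)` if its difference quotient extends
to a map of class `C^m` on `U^[1]`. -/
def IsCn (K : Type u) [CommRing K] [TopologicalSpace K] {W : Type u} [AddCommGroup W] [Module K W]
    [TopologicalSpace W] : ℕ → ∀ {V : Type u} [AddCommGroup V] [Module K V] [TopologicalSpace V],
    (V → W) → Set V → Prop
  | 0, _, _, _, _, f, U => ContinuousOn f U
  | m + 1, V, _, _, _, f, U =>
      ∃ g : V × V × K → W, IsSlope K f U g ∧ IsCn K m g (extDomain K U)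

/-- Smooth over `K`: of class `C^m` for all `m`. -/
def IsSmoothOn (K : Type u) {V W : Type u} [CommRing K] [TopologicalSpace K]
    [AddCommGroup V] [Module K V] [TopologicalSpace V]
    [AddCommGroup W] [Module K W] [TopologicalSpace W] (f : V → W) (U : Set V) : Prop :=
  ∀ m : ℕ, IsCn K m f U

/-- Over a good ring, a continuous extension of the difference quotient from invertible scalars to
all of `U^[1]` satisfies the defining identity of `IsSlope` for all scalars. -/
theorem isSlope_of_isUnit [IsTopologicalRing K] [IsTopologicalAddGroup V] [ContinuousSMul K V]
    [IsTopologicalAddGroup W] [ContinuousSMul K W] [T2Space W] (hK : IsGood K)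
    {f : V → W} {U : Set V} (hU : IsOpen U) (hf : ContinuousOn f U) {g : V × V × K → W}
    (hg : ContinuousOn g (extDomain K U))
    (h : ∀ p ∈ extDomain K U, IsUnit p.2.2 → f (p.1 + p.2.2 • p.2.1) - f p.1 = p.2.2 • g p) :
    IsSlope K f U g := by
  have hc : Continuous fun p : V × V × K => p.1 + p.2.2 • p.2.1 := by fun_prop
  have ho : IsOpen (extDomain K U) := (hU.preimage continuous_fst).inter (hU.preimage hc)
  have hd : Dense {p : V × V × K | IsUnit p.2.2} := by
    have h2 := (dense_univ (X := V)).prod ((dense_univ (X := V)).prod hK)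
    exact h2.mono fun p hp => hp.2.2
  have hsub : extDomain K U ⊆ closure (extDomain K U ∩ {p | IsUnit p.2.2}) :=
    hd.open_subset_closure_inter ho
  have e1 : ContinuousOn (fun p : V × V × K => f (p.1 + p.2.2 • p.2.1) - f p.1)
      (extDomain K U) :=
    (hf.comp hc.continuousOn fun p hp => hp.2).sub
      (hf.comp continuous_fst.continuousOn fun p hp => hp.1)
  have e2 : ContinuousOn (fun p : V × V × K => p.2.2 • g p) (extDomain K U) :=
    ContinuousOn.smul (by fun_prop) hg
  have key : Set.EqOn (fun p : V × V × K => f (p.1 + p.2.2 • p.2.1) - f p.1)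
      (fun p => p.2.2 • g p) (extDomain K U) :=
    Set.EqOn.of_subset_closure (fun p hp => h p hp.1 hp.2) e1 e2 Set.inter_subset_left hsub
  exact fun p hp => key hp

open Classical in
/-- The continuous difference quotient map `f^[1]` on `U^[1]` (unique there if `K` is good, `U` is
open and `W` is Hausdorff); zero if there is none. -/
noncomputable def slope (K : Type u) {V W : Type u} [CommRing K] [TopologicalSpace K]
    [AddCommGroup V] [Module K V] [TopologicalSpace V]
    [AddCommGroup W] [Module K W] [TopologicalSpace W] (f : V → W) (U : Set V) : V × V × K → W :=
  if h : ∃ g : V × V × K → W, IsSlope K f U g ∧ ContinuousOn g (extDomain K U)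
  then h.choose else 0

/-- `U_t = {(x, v) | x ∈ U, x + t v ∈ U}`. -/
def tangentDomain (t : K) (U : Set V) : Set (V × V) :=
  {p | p.1 ∈ U ∧ p.1 + t • p.2 ∈ U}

/-- `f_t (x, v) = (f x, f^[1] (x, v, t))`. -/
noncomputable def tangentMap (t : K) (f : V → W) (U : Set V) (p : V × V) : W × W :=
  (f p.1, slope K f U (p.1, p.2, t))

end Calculus

section Cube

variable {n : ℕ} {K V W : Type u}

/-- Families `(v_B)` of elements of `V` indexed by the subsets `B` of `A`, also thought of as
sums `∑ B ⊆ A, v_B e_B`. -/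
def Cube (A : Finset (Fin n)) (V : Type u) : Type u := {B : Finset (Fin n) // B ⊆ A} → V

instance (A : Finset (Fin n)) [AddCommGroup V] : AddCommGroup (Cube A V) :=
  inferInstanceAs (AddCommGroup ({B : Finset (Fin n) // B ⊆ A} → V))

instance (A : Finset (Fin n)) [CommRing K] [AddCommGroup V] [Module K V] : Module K (Cube A V) :=
  inferInstanceAs (Module K ({B : Finset (Fin n) // B ⊆ A} → V))

instance (A : Finset (Fin n)) [TopologicalSpace V] : TopologicalSpace (Cube A V) :=
  inferInstanceAs (TopologicalSpace ({B : Finset (Fin n) // B ⊆ A} → V))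

/-- The decomposition of `∑ B ⊆ A, v_B e_B` as `x + y e_k` with `x, y` indexed by the subsets of
`A \ {k}`. -/
def Cube.split {A : Finset (Fin n)} {k : Fin n} (hk : k ∈ A) (v : Cube A V) :
    Cube (A.erase k) V × Cube (A.erase k) V :=
  (fun B => v ⟨B.1, B.2.trans (Finset.erase_subset k A)⟩,
   fun B => v ⟨insert k B.1, Finset.insert_subset hk (B.2.trans (Finset.erase_subset k A))⟩)

/-- The inverse of `Cube.split`. -/
def Cube.join {A : Finset (Fin n)} {k : Fin n} (p : Cube (A.erase k) V × Cube (A.erase k) V) :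
    Cube A V :=
  fun B => if h : k ∈ B.1 then p.2 ⟨B.1.erase k, Finset.erase_subset_erase k B.2⟩
    else p.1 ⟨B.1, Finset.subset_erase.2 ⟨B.2, h⟩⟩

variable [CommRing K] [TopologicalSpace K] [AddCommGroup V] [Module K V] [TopologicalSpace V]
  [AddCommGroup W] [Module K W] [TopologicalSpace W]

/-- The vertex set `U_t^{A;n}`: the constructions `U ↦ U_(t_k)` for `k ∈ A` are applied one after
the other, in increasing order of `k`. -/
noncomputable def cubeDomain (t : Fin n → K) (A : Finset (Fin n)) (U : Set V) : Set (Cube A V) :=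
  if h : A.Nonempty then
    {v | Cube.split (A.max'_mem h) v ∈
      tangentDomain (t (A.max' h)) (cubeDomain t (A.erase (A.max' h)) U)}
  else {v | v ⟨∅, Finset.empty_subset A⟩ ∈ U}
termination_by A.card
decreasing_by exact Finset.card_erase_lt_of_mem (A.max'_mem h)

/-- The map `f_t^{A;n} : U_t^{A;n} → W_t^{A;n}`: the constructions `f ↦ f_(t_k)` for `k ∈ A` are
applied one after the other, in increasing order of `k`. -/
noncomputable def cubeMap (t : Fin n → K) (A : Finset (Fin n)) (f : V → W) (U : Set V) :
    Cube A V → Cube A W :=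
  if h : A.Nonempty then
    fun v => Cube.join (tangentMap (t (A.max' h)) (cubeMap t (A.erase (A.max' h)) f U)
      (cubeDomain t (A.erase (A.max' h)) U) (Cube.split (A.max'_mem h) v))
  else fun v _ => f (v ⟨∅, Finset.empty_subset A⟩)
termination_by A.card
decreasing_by exact Finset.card_erase_lt_of_mem (A.max'_mem h)

end Cube

section Ring

variable {n : ℕ} {K V : Type u} [CommRing K] [AddCommGroup V] [Module K V]

/-- The vertex ring `K_t^{A;n}`: the free `K`-module with basis `e_B`, `B ⊆ A`, with the product
given by `e_B e_C = t_(B ∩ C) e_(B ∪ C)`, where `t_B = ∏ i ∈ B, t_i`. -/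
def VertexRing {K : Type u} (_t : Fin n → K) (A : Finset (Fin n)) : Type u := Cube A K

instance (t : Fin n → K) (A : Finset (Fin n)) : AddCommGroup (VertexRing t A) :=
  inferInstanceAs (AddCommGroup (Cube A K))

instance (t : Fin n → K) (A : Finset (Fin n)) [TopologicalSpace K] :
    TopologicalSpace (VertexRing t A) :=
  inferInstanceAs (TopologicalSpace (Cube A K))

/-- The bilinear extension of `(a e_B, v e_C) ↦ (t_(B ∩ C) a v) e_(B ∪ C)`. -/
def cubeMul (t : Fin n → K) {A : Finset (Fin n)} (a : Cube A K) (v : Cube A V) : Cube A V :=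
  fun D => ∑ B : {B : Finset (Fin n) // B ⊆ A}, ∑ C : {C : Finset (Fin n) // C ⊆ A},
    if B.1 ∪ C.1 = D.1 then ((∏ i ∈ B.1 ∩ C.1, t i) * a B) • v C else 0

theorem prod_inter_assoc (t : Fin n → K) (P Q C : Finset (Fin n)) :
    (∏ i ∈ (P ∪ Q) ∩ C, t i) * ∏ i ∈ P ∩ Q, t i
      = (∏ i ∈ P ∩ (Q ∪ C), t i) * ∏ i ∈ Q ∩ C, t i := by
  have key : ∀ S : Finset (Fin n), ∏ i ∈ S, t i = ∏ i, if i ∈ S then t i else 1 := by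
    intro S; simp [Finset.prod_ite_mem]
  rw [key, key, key, key, ← Finset.prod_mul_distrib, ← Finset.prod_mul_distrib]
  refine Finset.prod_congr rfl fun i _ => ?_
  by_cases hP : i ∈ P <;> by_cases hQ : i ∈ Q <;> by_cases hC : i ∈ C <;> simp [hP, hQ, hC]

theorem cubeMul_add_left (t : Fin n → K) {A : Finset (Fin n)} (a b : Cube A K) (v : Cube A V) :
    cubeMul t (a + b) v = cubeMul t a v + cubeMul t b v := by
  funext D
  change _ = cubeMul t a v D + cubeMul t b v D
  simp only [cubeMul, ← Finset.sum_add_distrib]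
  refine Finset.sum_congr rfl fun B _ => Finset.sum_congr rfl fun C _ => ?_
  have : (a + b) B = a B + b B := rfl
  split_ifs <;> simp [this, mul_add, add_smul]

theorem cubeMul_add_right (t : Fin n → K) {A : Finset (Fin n)} (a : Cube A K) (v w : Cube A V) :
    cubeMul t a (v + w) = cubeMul t a v + cubeMul t a w := by
  funext D
  change _ = cubeMul t a v D + cubeMul t a w D
  simp only [cubeMul, ← Finset.sum_add_distrib]
  refine Finset.sum_congr rfl fun B _ => Finset.sum_congr rfl fun C _ => ?_
  have : (v + w) C = v C + w C := rfl
  split_ifs <;> simp [this]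

/-- The family with the single entry `x` at `B`. -/
def cubeSingle {A : Finset (Fin n)} (B : {B : Finset (Fin n) // B ⊆ A}) (x : V) : Cube A V :=
  fun D => if B = D then x else 0

theorem cubeMul_single (t : Fin n → K) {A : Finset (Fin n)} (B C : {B : Finset (Fin n) // B ⊆ A})
    (a : K) (x : V) :
    cubeMul t (cubeSingle B a) (cubeSingle C x) =
      cubeSingle ⟨B.1 ∪ C.1, Finset.union_subset B.2 C.2⟩ (((∏ i ∈ B.1 ∩ C.1, t i) * a) • x) := by
  funext D
  simp only [cubeMul, cubeSingle]
  rw [Finset.sum_eq_single B, Finset.sum_eq_single C]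
  · simp [Subtype.ext_iff]
  · intro C' _ h; simp [h.symm]
  · simp
  · intro B' _ h; simp [h.symm]
  · simp

theorem cube_induction {A : Finset (Fin n)} {p : Cube A V → Prop} (h0 : p 0)
    (hadd : ∀ v w, p v → p w → p (v + w)) (hs : ∀ B x, p (cubeSingle B x)) (v : Cube A V) :
    p v := by
  have h : v = ∑ B, cubeSingle B (v B) := by
    funext D
    have e : (∑ B, cubeSingle B (v B)) D = ∑ B, cubeSingle B (v B) D :=
      Finset.sum_apply D Finset.univ fun B => (cubeSingle B (v B) : _ → V)
    rw [e, Finset.sum_eq_single D]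
    · simp [cubeSingle]
    · intro B _ hB
      simp [cubeSingle, hB]
    · simp
  rw [h]
  exact Finset.sum_induction _ p hadd h0 fun B _ => hs B _

theorem cubeMul_zero_left (t : Fin n → K) {A : Finset (Fin n)} (v : Cube A V) :
    cubeMul t (0 : Cube A K) v = 0 := by
  have := cubeMul_add_left t (0 : Cube A K) 0 v
  simpa using this

theorem cubeMul_zero_right (t : Fin n → K) {A : Finset (Fin n)} (a : Cube A K) :
    cubeMul t a (0 : Cube A V) = 0 := by
  have := cubeMul_add_right t a (0 : Cube A V) 0
  simpa using this

theorem cubeMul_assoc (t : Fin n → K) {A : Finset (Fin n)} (a b : Cube A K) (v : Cube A V) :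
    cubeMul t (cubeMul t a b) v = cubeMul t a (cubeMul t b v) := by
  induction a using cube_induction with
  | h0 => simp only [cubeMul_zero_left]
  | hadd a a' h h' => simp only [cubeMul_add_left, h, h']
  | hs P x =>
    induction b using cube_induction with
    | h0 => simp only [cubeMul_zero_left, cubeMul_zero_right]
    | hadd b b' h h' => simp only [cubeMul_add_left, cubeMul_add_right, h, h']
    | hs Q y =>
      induction v using cube_induction with
      | h0 => simp only [cubeMul_zero_right]
      | hadd v v' h h' => simp only [cubeMul_add_right, h, h']
      | hs C z =>
        simp only [cubeMul_single]
        have e : (∏ i ∈ (P.1 ∪ Q.1) ∩ C.1, t i) * (((∏ i ∈ P.1 ∩ Q.1, t i) * x) • y)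
            = ((∏ i ∈ P.1 ∩ (Q.1 ∪ C.1), t i) * x) * ((∏ i ∈ Q.1 ∩ C.1, t i) * y) := by
          rw [smul_eq_mul]
          linear_combination (x * y) * prod_inter_assoc t P.1 Q.1 C.1
        rw [e, mul_smul]
        congr 1
        exact Subtype.ext (Finset.union_assoc P.1 Q.1 C.1)

theorem cubeMul_comm (t : Fin n → K) {A : Finset (Fin n)} (a b : Cube A K) :
    cubeMul t a b = cubeMul t b a := by
  induction a using cube_induction with
  | h0 => simp only [cubeMul_zero_left, cubeMul_zero_right]
  | hadd a a' h h' => simp only [cubeMul_add_left, cubeMul_add_right, h, h']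
  | hs P x =>
    induction b using cube_induction with
    | h0 => simp only [cubeMul_zero_left, cubeMul_zero_right]
    | hadd b b' h h' => simp only [cubeMul_add_left, cubeMul_add_right, h, h']
    | hs Q y =>
      simp only [cubeMul_single, smul_eq_mul]
      congr 1
      · exact Subtype.ext (Finset.union_comm P.1 Q.1)
      · rw [Finset.inter_comm]; ring

theorem cubeMul_one (t : Fin n → K) {A : Finset (Fin n)} (v : Cube A V) :
    cubeMul t (cubeSingle ⟨∅, Finset.empty_subset A⟩ (1 : K)) v = v := by
  induction v using cube_induction with
  | h0 => simp only [cubeMul_zero_right]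
  | hadd v v' h h' => simp only [cubeMul_add_right, h, h']
  | hs C z => simp [cubeMul_single]

instance (t : Fin n → K) (A : Finset (Fin n)) : CommRing (VertexRing t A) :=
  { (inferInstance : AddCommGroup (VertexRing t A)) with
    mul := fun a b => cubeMul (V := K) t a b
    one := cubeSingle ⟨∅, Finset.empty_subset A⟩ (1 : K)
    left_distrib := fun a b c => cubeMul_add_right (V := K) t a b c
    right_distrib := fun a b c => cubeMul_add_left (V := K) t a b c
    zero_mul := fun a => cubeMul_zero_left (V := K) t a
    mul_zero := fun a => cubeMul_zero_right (V := K) t a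
    mul_assoc := fun a b c => cubeMul_assoc (V := K) t a b c
    one_mul := fun a => cubeMul_one (V := K) t a
    mul_one := fun a => (cubeMul_comm t a _).trans (cubeMul_one (V := K) t a)
    mul_comm := fun a b => cubeMul_comm t a b }

/-- The scalar extension `V_t^{A;n} = ⨁ B ⊆ A, V e_B` is a module over `K_t^{A;n}`, with
`(a e_B) (v e_C) = (t_(B ∩ C) a v) e_(B ∪ C)`. -/
instance (t : Fin n → K) (A : Finset (Fin n)) : Module (VertexRing t A) (Cube A V) where
  smul a v := cubeMul t a v
  one_smul v := cubeMul_one t v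
  mul_smul a b v := cubeMul_assoc t a b v
  smul_zero a := cubeMul_zero_right t a
  smul_add a v w := cubeMul_add_right t a v w
  add_smul a b v := cubeMul_add_left t a b v
  zero_smul v := cubeMul_zero_left t v

theorem continuous_cubeMul (t : Fin n → K) (A : Finset (Fin n)) [TopologicalSpace K]
    [IsTopologicalRing K] [TopologicalSpace V] [IsTopologicalAddGroup V] [ContinuousSMul K V] :
    Continuous fun p : Cube A K × Cube A V => cubeMul t p.1 p.2 := by
  refine continuous_pi fun D => ?_
  have h : ∀ B C : {B : Finset (Fin n) // B ⊆ A}, Continuous fun p : Cube A K × Cube A V =>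
      if B.1 ∪ C.1 = D.1 then ((∏ i ∈ B.1 ∩ C.1, t i) * p.1 B) • p.2 C else 0 := by
    intro B C
    by_cases h : B.1 ∪ C.1 = D.1
    · simp only [if_pos h]
      exact (continuous_const.mul ((continuous_apply B).comp continuous_fst)).smul
        ((continuous_apply C).comp continuous_snd)
    · simp only [if_neg h]
      exact continuous_const
  exact continuous_finsetSum _ fun B _ => continuous_finsetSum _ fun C _ => h B C

instance (A : Finset (Fin n)) [TopologicalSpace V] [IsTopologicalAddGroup V] :
    IsTopologicalAddGroup (Cube A V) :=
  inferInstanceAs (IsTopologicalAddGroup ({B : Finset (Fin n) // B ⊆ A} → V))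

instance (t : Fin n → K) (A : Finset (Fin n)) [TopologicalSpace K] [IsTopologicalRing K] :
    IsTopologicalRing (VertexRing t A) where
  continuous_add := (inferInstance : IsTopologicalAddGroup (Cube A K)).continuous_add
  continuous_neg := (inferInstance : IsTopologicalAddGroup (Cube A K)).continuous_neg
  continuous_mul := continuous_cubeMul (V := K) t A

instance (t : Fin n → K) (A : Finset (Fin n)) [TopologicalSpace K] [IsTopologicalRing K]
    [TopologicalSpace V] [IsTopologicalAddGroup V] [ContinuousSMul K V] :
    ContinuousSMul (VertexRing t A) (Cube A V) where
  continuous_smul := continuous_cubeMul t A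

end Ring

section Manifold

variable {n : ℕ} {K V W : Type u} [CommRing K] [TopologicalSpace K]
  [AddCommGroup V] [Module K V] [TopologicalSpace V]
  [AddCommGroup W] [Module K W] [TopologicalSpace W]
  {M N : Type*} [TopologicalSpace M] [TopologicalSpace N]

/-- `𝒜` is an atlas of a smooth manifold over `K` modelled on `V`. -/
structure IsSmoothAtlas (K : Type u) {V : Type u} {M : Type*} [CommRing K] [TopologicalSpace K]
    [AddCommGroup V] [Module K V] [TopologicalSpace V] [TopologicalSpace M]
    (𝒜 : Set (OpenPartialHomeomorph M V)) : Prop where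
  cover : ∀ p : M, ∃ c ∈ 𝒜, p ∈ c.source
  smooth : ∀ c ∈ 𝒜, ∀ d ∈ 𝒜, IsSmoothOn K (d ∘ c.symm) (c.target ∩ c.symm ⁻¹' d.source)

/-- The domain of the chart expression `d ∘ f ∘ c⁻¹` of `f : M → N`. -/
def exprDomain (c : OpenPartialHomeomorph M V) (d : OpenPartialHomeomorph N W) (f : M → N) :
    Set V :=
  c.target ∩ c.symm ⁻¹' (f ⁻¹' d.source)

/-- `f : M → N` is smooth over `K`: it is continuous and its expressions in the charts of the
atlases are smooth. -/
structure IsSmoothMap (K : Type u) {V W : Type u} {M N : Type*} [CommRing K] [TopologicalSpace K]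
    [AddCommGroup V] [Module K V] [TopologicalSpace V]
    [AddCommGroup W] [Module K W] [TopologicalSpace W] [TopologicalSpace M] [TopologicalSpace N]
    (𝒜 : Set (OpenPartialHomeomorph M V)) (ℬ : Set (OpenPartialHomeomorph N W))
    (f : M → N) : Prop where
  continuous : Continuous f
  smooth : ∀ c ∈ 𝒜, ∀ d ∈ ℬ, IsSmoothOn K (d ∘ f ∘ c.symm) (exprDomain c d f)

/-- The atlas contains every chart that is compatible with all its charts. -/
def IsMaximalAtlas (K : Type u) {V : Type u} {M : Type*} [CommRing K] [TopologicalSpace K]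
    [AddCommGroup V] [Module K V] [TopologicalSpace V] [TopologicalSpace M]
    (𝒜 : Set (OpenPartialHomeomorph M V)) : Prop :=
  ∀ c : OpenPartialHomeomorph M V,
    (∀ d ∈ 𝒜, IsSmoothOn K (d ∘ c.symm) (c.target ∩ c.symm ⁻¹' d.source) ∧
      IsSmoothOn K (c ∘ d.symm) (d.target ∩ d.symm ⁻¹' c.source)) → c ∈ 𝒜

/-- Any finitely many points lie in the (possibly disconnected) domain of one chart. -/
def HasCommonCharts (𝒜 : Set (OpenPartialHomeomorph M V)) : Prop :=
  ∀ s : Finset M, s.Nonempty → ∃ c ∈ 𝒜, (s : Set M) ⊆ c.source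

/-- The disjoint union of the sets `(c.target)_t^{A;n}` over all charts `c` of the atlas. -/
def PreVertex (𝒜 : Set (OpenPartialHomeomorph M V)) (t : Fin n → K) (A : Finset (Fin n)) :
    Type _ :=
  Σ c : 𝒜, cubeDomain t A c.1.target

instance (𝒜 : Set (OpenPartialHomeomorph M V)) (t : Fin n → K) (A : Finset (Fin n)) :
    TopologicalSpace (PreVertex 𝒜 t A) :=
  inferInstanceAs (TopologicalSpace (Σ c : 𝒜, cubeDomain t A c.1.target))

/-- Two points are glued if the extension `τ_t^{A;n}` of the transition map `τ = d ∘ c⁻¹`, which is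
defined on the set `O_t^{A;n}` for the domain `O` of `τ`, maps the first to the second. -/
def PreVertex.Glued (𝒜 : Set (OpenPartialHomeomorph M V)) (t : Fin n → K) (A : Finset (Fin n))
    (p q : PreVertex 𝒜 t A) : Prop :=
  p.2.1 ∈ cubeDomain t A (p.1.1.target ∩ p.1.1.symm ⁻¹' q.1.1.source) ∧
    cubeMap t A (q.1.1 ∘ p.1.1.symm) (p.1.1.target ∩ p.1.1.symm ⁻¹' q.1.1.source) p.2.1 = q.2.1

/-- The vertex manifold `M_t^{A;n}`, glued from the sets `(c.target)_t^{A;n}`. -/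
def Vertex (𝒜 : Set (OpenPartialHomeomorph M V)) (t : Fin n → K) (A : Finset (Fin n)) : Type _ :=
  Quot (PreVertex.Glued 𝒜 t A)

instance (𝒜 : Set (OpenPartialHomeomorph M V)) (t : Fin n → K) (A : Finset (Fin n)) :
    TopologicalSpace (Vertex 𝒜 t A) :=
  inferInstanceAs (TopologicalSpace (Quot (PreVertex.Glued 𝒜 t A)))

/-- The point of `M_t^{A;n}` with coordinate `z` in the chart induced by `c`. -/
def Vertex.mk {𝒜 : Set (OpenPartialHomeomorph M V)} {t : Fin n → K} {A : Finset (Fin n)} (c : 𝒜)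
    (z : cubeDomain t A c.1.target) : Vertex 𝒜 t A :=
  Quot.mk _ ⟨c, z⟩

/-- `C` is the chart of `M_t^{A;n}` induced by the chart `c` of `M`. -/
def IsVertexChart {𝒜 : Set (OpenPartialHomeomorph M V)} (t : Fin n → K) (A : Finset (Fin n))
    (c : 𝒜) (C : OpenPartialHomeomorph (Vertex 𝒜 t A) (Cube A V)) : Prop :=
  C.target = cubeDomain t A c.1.target ∧
    ∀ z : cubeDomain t A c.1.target, C.symm z.1 = Vertex.mk c z

/-- The atlas of `M_t^{A;n}` consisting of the induced charts. -/
def vertexAtlas (𝒜 : Set (OpenPartialHomeomorph M V)) (t : Fin n → K) (A : Finset (Fin n)) :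
    Set (OpenPartialHomeomorph (Vertex 𝒜 t A) (Cube A V)) :=
  {C | ∃ c : 𝒜, IsVertexChart t A c C}

/-- `F` is the map `f_t^{A;n} : M_t^{A;n} → N_t^{A;n}`: in the induced charts it is given by the
extensions `φ_t^{A;n}` of the chart expressions `φ = d ∘ f ∘ c⁻¹`. -/
def IsVertexMap (𝒜 : Set (OpenPartialHomeomorph M V)) (ℬ : Set (OpenPartialHomeomorph N W))
    (t : Fin n → K) (A : Finset (Fin n)) (f : M → N) (F : Vertex 𝒜 t A → Vertex ℬ t A) : Prop :=
  ∀ (c : 𝒜) (d : ℬ) (z : cubeDomain t A c.1.target),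
    z.1 ∈ cubeDomain t A (exprDomain c.1 d.1 f) →
    ∃ w : cubeDomain t A d.1.target,
      w.1 = cubeMap t A (d.1 ∘ f ∘ c.1.symm) (exprDomain c.1 d.1 f) z.1 ∧
      F (Vertex.mk c z) = Vertex.mk d w

end Manifold

end LieCalculus

set_option linter.unusedSectionVars false

namespace LieCalculus


/-! ### Stability of the classes `C^m` under the usual operations -/

section IsCn

variable {K V W X : Type u} [CommRing K] [TopologicalSpace K]
  [AddCommGroup V] [Module K V] [TopologicalSpace V]
  [AddCommGroup W] [Module K W] [TopologicalSpace W]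
  [AddCommGroup X] [Module K X] [TopologicalSpace X]

/-! The argument rests on two observations. First, a point `v` of `V_t^{A;n}` has finitely many
vertices `∑ B ⊆ S ∩ A, t_B v_B` in `V`. It lies in `U_t^{A;n}` exactly when all of them lie in `U`
(`mem_cubeDomain_iff`), and `f_t^{A;n}` acts on vertices by `f` (`cubeVertex_cubeMap`). Density of
the units makes difference quotients unique, so the construction does not depend on the domain and
satisfies a chain rule (`cubeMap_congr`, `cubeMap_comp`).

Second, extension respects sums and turns a product `L x • h x` with `L` linear into the product
over the vertex ring, because at each step the product rule for difference quotients is the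
multiplication rule `e_k ^ 2 = t_k e_k` (`cubeMap_smul`). Extending the identity `f (x + s v) = f x
+ s f^[1] (x, v, s)` on `U^[1]` therefore gives the same identity over the vertex ring, with the
extension of `f^[1]` as difference quotient. Induction on `m` shows that `f_t^{A;n}` is smooth over
the vertex ring (`IsSmoothOn.cubeMap_vertexRing`).

For manifolds, vertices are well-defined points of `M`, and two coordinate points with the same
vertices always lie in a common induced chart. Hence gluing is an equivalence relation and induced
charts are open embeddings. Points with a different vertex are separated in `M`, all others inside
one chart. The map `f_t^{A;n}` is determined at a point once the `f`-images of its vertices lie in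
one chart of `N`, and functoriality makes the result independent of the charts.

Over a field with continuous inversion such a chart exists in a maximal atlas: small charts around
the points are translated to have disjoint images, and their union is a chart. It is compatible
because being `C^m` is then a local property (`isCn_of_local`): a scalar is either invertible, where
the quotient is explicit, or zero, where both endpoints coincide. -/

theorem isCn_zero {f : V → W} {U : Set V} : IsCn K 0 f U ↔ ContinuousOn f U := Iff.rfl

theorem extDomain_mono {U U' : Set V} (h : U' ⊆ U) : extDomain K U' ⊆ extDomain K U :=
  fun _ hp => ⟨h hp.1, h hp.2⟩

theorem IsSlope.congr {f f' : V → W} {U U' : Set V} {g : V × V × K → W} (h : IsSlope K f U g)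
    (hU : U' ⊆ U) (hf : Set.EqOn f f' U') : IsSlope K f' U' g := by
  intro p hp
  rw [← hf hp.1, ← hf hp.2]
  exact h p (extDomain_mono hU hp)

theorem IsCn.congr {m : ℕ} {f f' : V → W} {U U' : Set V} (h : IsCn K m f U)
    (hU : U' ⊆ U) (hf : Set.EqOn f f' U') : IsCn K m f' U' := by
  induction m generalizing V with
  | zero => exact (ContinuousOn.mono h hU).congr fun x hx => (hf hx).symm
  | succ m ih =>
    obtain ⟨g, hg, hg'⟩ := h
    exact ⟨g, hg.congr hU hf, ih hg' (extDomain_mono hU) fun _ _ => rfl⟩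

theorem IsCn.mono {m : ℕ} {f : V → W} {U U' : Set V} (h : IsCn K m f U)
    (hU : U' ⊆ U) : IsCn K m f U' :=
  h.congr hU fun _ _ => rfl

/-- For `m = 0`, the scalar `1` and the direction `y - x` give `f y = f x + g (x, y - x, 1)`, which
is continuous in `y`. Higher orders follow by applying this to the difference quotient. -/
theorem IsCn.of_succ [ContinuousAdd W] [IsTopologicalAddGroup V] {m : ℕ}
    [IsTopologicalAddGroup K] {f : V → W} {U : Set V}
    (h : IsCn K (m + 1) f U) : IsCn K m f U := by
  induction m generalizing V with
  | zero =>
    obtain ⟨g, hg, hg'⟩ := h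
    rw [isCn_zero] at hg' ⊢
    intro x hx
    have hc : ContinuousOn (fun y => f x + g (x, y - x, 1)) U := by
      refine continuousOn_const.add (hg'.comp (by fun_prop) ?_)
      intro y hy
      exact ⟨hx, by simpa using hy⟩
    refine (hc.congr ?_) x hx
    intro y hy
    have := hg (x, y - x, 1) ⟨hx, by simpa using hy⟩
    simp only [one_smul, add_sub_cancel] at this
    simp [← this]
  | succ m ih =>
    obtain ⟨g, hg, hg'⟩ := h
    exact ⟨g, hg, ih hg'⟩

theorem IsCn.continuousOn [ContinuousAdd W] [IsTopologicalAddGroup V] {m : ℕ}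
    [IsTopologicalAddGroup K] {f : V → W} {U : Set V}
    (h : IsCn K m f U) : ContinuousOn f U := by
  induction m with
  | zero => exact h
  | succ m ih => exact ih h.of_succ

theorem isSlope_clm (L : V →L[K] W) (U : Set V) : IsSlope K L U fun p => L p.2.1 :=
  fun p _ => by simp

theorem IsCn.clm {m : ℕ} (L : V →L[K] W) (U : Set V) : IsCn K m L U := by
  induction m generalizing V with
  | zero => exact L.continuous.continuousOn
  | succ m ih =>
    refine ⟨fun p => L p.2.1, isSlope_clm L U, ?_⟩
    exact ih (L.comp ((ContinuousLinearMap.fst K V K).comp (ContinuousLinearMap.snd K V (V × K)))) _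

theorem IsCn.const {m : ℕ} (c : W) (U : Set V) : IsCn K m (fun _ : V => c) U := by
  induction m generalizing V c with
  | zero => exact continuousOn_const
  | succ m ih => exact ⟨fun _ => 0, fun p _ => by simp, ih _ _⟩

theorem IsCn.prodMk {m : ℕ} {f : V → W} {g : V → X} {U : Set V} (hf : IsCn K m f U)
    (hg : IsCn K m g U) : IsCn K m (fun x => (f x, g x)) U := by
  induction m generalizing V with
  | zero => exact ContinuousOn.prodMk hf hg
  | succ m ih =>
    obtain ⟨f', h1, h2⟩ := hf
    obtain ⟨g', h3, h4⟩ := hg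
    exact ⟨fun p => (f' p, g' p), fun p hp => Prod.ext (h1 p hp) (h3 p hp), ih h2 h4⟩

/-- Composition with a continuous linear map on the right. -/
theorem IsCn.comp_clm {m : ℕ} {g : W → X} {U : Set W} (hg : IsCn K m g U) (L : V →L[K] W) :
    IsCn K m (fun x => g (L x)) (L ⁻¹' U) := by
  induction m generalizing V W with
  | zero => exact ContinuousOn.comp hg L.continuous.continuousOn fun _ h => h
  | succ m ih =>
    obtain ⟨g', h1, h2⟩ := hg
    refine ⟨fun p => g' (L p.1, L p.2.1, p.2.2), ?_, ?_⟩
    · intro p hp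
      have := h1 (L p.1, L p.2.1, p.2.2) ⟨hp.1, by simpa using hp.2⟩
      simpa using this
    · refine (ih h2 (L.prodMap (L.prodMap (ContinuousLinearMap.id K K)))).mono ?_
      intro p hp
      exact ⟨hp.1, by simpa using hp.2⟩

variable [IsTopologicalRing K] [IsTopologicalAddGroup V] [ContinuousSMul K V]
  [IsTopologicalAddGroup W] [ContinuousSMul K W]
  [IsTopologicalAddGroup X] [ContinuousSMul K X]

/-- The difference quotient of a composition. -/
theorem IsSlope.comp {f : V → W} {g : W → X} {U : Set V} {U' : Set W} {f' : V × V × K → W}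
    {g' : W × W × K → X} (hg : IsSlope K g U' g') (hf : IsSlope K f U f') (h : Set.MapsTo f U U') :
    IsSlope K (fun x => g (f x)) U (fun p => g' (f p.1, f' p, p.2.2)) ∧
      Set.MapsTo (fun p : V × V × K => (f p.1, f' p, p.2.2)) (extDomain K U) (extDomain K U') := by
  have key : ∀ p ∈ extDomain K U, f p.1 + p.2.2 • f' p = f (p.1 + p.2.2 • p.2.1) := fun p hp => by
    rw [← hf p hp, add_sub_cancel]
  have hm : Set.MapsTo (fun p : V × V × K => (f p.1, f' p, p.2.2)) (extDomain K U)
      (extDomain K U') := fun p hp =>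
    ⟨h hp.1, by simp only [key p hp]; exact h hp.2⟩
  refine ⟨fun p hp => ?_, hm⟩
  have := hg _ (hm hp)
  simp only [key p hp] at this
  exact this

/-- The quotient `g' (f x, f' (x, v, s), s)` is again a composition, one order lower. It contains
`f` itself, which is why `f` must also be known to be of the lower class. -/
theorem IsCn.comp {m : ℕ} {g : W → X} {f : V → W} {U : Set V} {U' : Set W} (hg : IsCn K m g U')
    (hf : IsCn K m f U) (h : Set.MapsTo f U U') : IsCn K m (fun x => g (f x)) U := by
  induction m generalizing V W with
  | zero => exact ContinuousOn.comp hg hf h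
  | succ m ih =>
    have hf0 := hf.of_succ
    obtain ⟨f', h1, h2⟩ := hf
    obtain ⟨g', h3, h4⟩ := hg
    refine ⟨_, (h3.comp h1 h).1, ih h4 (.prodMk ?_ (.prodMk h2 ?_)) (h3.comp h1 h).2⟩
    · exact (hf0.comp_clm (ContinuousLinearMap.fst K V (V × K))).mono fun p hp => hp.1
    · exact .clm ((ContinuousLinearMap.snd K V K).comp (ContinuousLinearMap.snd K V (V × K))) _

theorem IsCn.add {m : ℕ} {f g : V → W} {U : Set V} (hf : IsCn K m f U)
    (hg : IsCn K m g U) : IsCn K m (fun x => f x + g x) U :=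
  (IsCn.clm (ContinuousLinearMap.fst K W W + ContinuousLinearMap.snd K W W) Set.univ).comp
    (hf.prodMk hg) fun _ _ => trivial

theorem IsCn.smul_prod {m : ℕ} (U : Set (K × W)) : IsCn K m (fun p : K × W => p.1 • p.2) U := by
  induction m generalizing U with
  | zero => exact (continuous_fst.smul continuous_snd).continuousOn
  | succ m ih =>
    have key : ∀ {a : (K × W) × (K × W) × K → K} {b : (K × W) × (K × W) × K → W} {D},
        IsCn K m a D → IsCn K m b D → IsCn K m (fun p => a p • b p) D := fun ha hb =>
      (ih Set.univ).comp (ha.prodMk hb) fun _ _ => trivial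
    have h1 : IsCn K m (fun p : (K × W) × (K × W) × K => p.1) (extDomain K U) :=
      .clm (ContinuousLinearMap.fst K (K × W) ((K × W) × K)) _
    have h2 : IsCn K m (fun p : (K × W) × (K × W) × K => p.2.1) (extDomain K U) :=
      .clm ((ContinuousLinearMap.fst K (K × W) K).comp (ContinuousLinearMap.snd K (K × W) ((K × W) × K))) _
    have h3 : IsCn K m (fun p : (K × W) × (K × W) × K => p.2.2) (extDomain K U) :=
      .clm ((ContinuousLinearMap.snd K (K × W) K).comp
        (ContinuousLinearMap.snd K (K × W) ((K × W) × K))) _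
    have hf : ∀ {g : (K × W) × (K × W) × K → K × W} {D}, IsCn K m g D →
        IsCn K m (fun p => (g p).1) D := fun hg =>
      (IsCn.clm (ContinuousLinearMap.fst K K W) Set.univ).comp hg fun _ _ => trivial
    have hs : ∀ {g : (K × W) × (K × W) × K → K × W} {D}, IsCn K m g D →
        IsCn K m (fun p => (g p).2) D := fun hg =>
      (IsCn.clm (ContinuousLinearMap.snd K K W) Set.univ).comp hg fun _ _ => trivial
    -- This is `(a + τ a') (w + τ w') - a w` divided by `τ`. It is built from products of linear
    -- maps, so the induction hypothesis applies to it.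
    refine ⟨fun p => p.2.1.1 • p.1.2 + (p.1.1 • p.2.1.2 + p.2.2 • (p.2.1.1 • p.2.1.2)), ?_, ?_⟩
    · rintro ⟨⟨s, v⟩, ⟨s', v'⟩, τ⟩ -
      simp only [Prod.fst_add, Prod.snd_add, Prod.smul_fst, Prod.smul_snd, smul_eq_mul]
      module
    · exact (key (hf h2) (hs h1)).add ((key (hf h1) (hs h2)).add (key h3 (key (hf h2) (hs h2))))

theorem IsCn.smul {m : ℕ} {a : V → K} {f : V → W} {U : Set V} (ha : IsCn K m a U)
    (hf : IsCn K m f U) : IsCn K m (fun x => a x • f x) U :=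
  (IsCn.smul_prod Set.univ).comp (ha.prodMk hf) fun _ _ => trivial

end IsCn


/-! ### Uniqueness of difference quotients, and smooth maps -/

section Slope

variable {K V W X : Type u} [CommRing K] [TopologicalSpace K] [IsTopologicalRing K]
  [AddCommGroup V] [Module K V] [TopologicalSpace V] [IsTopologicalAddGroup V] [ContinuousSMul K V]
  [AddCommGroup W] [Module K W] [TopologicalSpace W] [IsTopologicalAddGroup W] [ContinuousSMul K W]

theorem isOpen_extDomain {U : Set V} (hU : IsOpen U) : IsOpen (extDomain K U) := by
  have hc : Continuous fun p : V × V × K => p.1 + p.2.2 • p.2.1 := by fun_prop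
  exact (hU.preimage continuous_fst).inter (hU.preimage hc)

/-- At invertible scalars the defining identity can be solved for the quotient. Such points are
dense in the open set `U^[1]`, and continuous maps into a Hausdorff space that agree there are
equal. -/
theorem IsSlope.eqOn [T2Space W] (hK : IsGood K) {f : V → W} {U : Set V} (hU : IsOpen U)
    {g g' : V × V × K → W} (hg : IsSlope K f U g) (hgc : ContinuousOn g (extDomain K U))
    (hg' : IsSlope K f U g') (hgc' : ContinuousOn g' (extDomain K U)) :
    Set.EqOn g g' (extDomain K U) := by
  have hd : Dense {p : V × V × K | IsUnit p.2.2} := by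
    have h2 := (dense_univ (X := V)).prod ((dense_univ (X := V)).prod hK)
    exact h2.mono fun p hp => hp.2.2
  have hsub : extDomain K U ⊆ closure (extDomain K U ∩ {p | IsUnit p.2.2}) :=
    hd.open_subset_closure_inter (isOpen_extDomain hU)
  refine Set.EqOn.of_subset_closure (fun p hp => ?_) hgc hgc' Set.inter_subset_left hsub
  exact hp.2.smul_left_cancel.1 ((hg p hp.1).symm.trans (hg' p hp.1))

theorem slope_eq [T2Space W] (hK : IsGood K) {f : V → W} {U : Set V} (hU : IsOpen U)
    {g : V × V × K → W} (hg : IsSlope K f U g) (hgc : ContinuousOn g (extDomain K U)) :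
    Set.EqOn (slope K f U) g (extDomain K U) := by
  have h : ∃ g : V × V × K → W, IsSlope K f U g ∧ ContinuousOn g (extDomain K U) := ⟨g, hg, hgc⟩
  rw [slope, dif_pos h]
  exact h.choose_spec.1.eqOn hK hU h.choose_spec.2 hg hgc

theorem IsSmoothOn.isSlope {f : V → W} {U : Set V} (hf : IsSmoothOn K f U) :
    IsSlope K f U (slope K f U) := by
  have h : ∃ g : V × V × K → W, IsSlope K f U g ∧ ContinuousOn g (extDomain K U) := hf 1
  rw [slope, dif_pos h]
  exact h.choose_spec.1

/-- Smoothness provides a quotient for each order separately. By uniqueness they all coincide on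
`U^[1]` with `slope`, which is thus of every class. -/
theorem IsSmoothOn.slope [T2Space W] (hK : IsGood K) {f : V → W} {U : Set V} (hU : IsOpen U)
    (hf : IsSmoothOn K f U) : IsSmoothOn K (slope K f U) (extDomain K U) := by
  intro m
  obtain ⟨g, hg, hg'⟩ := hf (m + 1)
  exact hg'.congr le_rfl (slope_eq hK hU hg hg'.continuousOn).symm

theorem IsSmoothOn.continuousOn {f : V → W} {U : Set V} (hf : IsSmoothOn K f U) :
    ContinuousOn f U := hf 0

theorem IsSmoothOn.congr {f f' : V → W} {U U' : Set V} (h : IsSmoothOn K f U)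
    (hU : U' ⊆ U) (hf : Set.EqOn f f' U') : IsSmoothOn K f' U' := fun m => (h m).congr hU hf

theorem IsSmoothOn.mono {f : V → W} {U U' : Set V} (h : IsSmoothOn K f U)
    (hU : U' ⊆ U) : IsSmoothOn K f U' := fun m => (h m).mono hU

variable [AddCommGroup X] [Module K X] [TopologicalSpace X] [IsTopologicalAddGroup X]
  [ContinuousSMul K X]

theorem IsSmoothOn.comp {g : W → X} {f : V → W} {U : Set V} {U' : Set W} (hg : IsSmoothOn K g U')
    (hf : IsSmoothOn K f U) (h : Set.MapsTo f U U') : IsSmoothOn K (fun x => g (f x)) U :=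
  fun m => (hg m).comp (hf m) h

theorem IsSmoothOn.add {f g : V → W} {U : Set V} (hf : IsSmoothOn K f U)
    (hg : IsSmoothOn K g U) : IsSmoothOn K (fun x => f x + g x) U :=
  fun m => (hf m).add (hg m)

theorem IsSmoothOn.prodMk {f : V → W} {g : V → X} {U : Set V} (hf : IsSmoothOn K f U)
    (hg : IsSmoothOn K g U) : IsSmoothOn K (fun x => (f x, g x)) U :=
  fun m => (hf m).prodMk (hg m)

theorem isSmoothOn_clm (L : V →L[K] W) (U : Set V) : IsSmoothOn K L U := fun _ => .clm L U

theorem IsSmoothOn.clm_comp (L : W →L[K] X) {f : V → W} {U : Set V} (hf : IsSmoothOn K f U) :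
    IsSmoothOn K (fun x => L (f x)) U :=
  (isSmoothOn_clm L Set.univ).comp hf fun _ _ => trivial

theorem isSmoothOn_const (c : W) (U : Set V) : IsSmoothOn K (fun _ => c) U := fun _ => .const c U

theorem IsSmoothOn.smul {a : V → K} {f : V → W} {U : Set V} (ha : IsSmoothOn K a U)
    (hf : IsSmoothOn K f U) : IsSmoothOn K (fun x => a x • f x) U :=
  fun m => (ha m).smul (hf m)

theorem IsSmoothOn.tangentMap [T2Space W] (hK : IsGood K) {f : V → W} {U : Set V} (hU : IsOpen U)
    (hf : IsSmoothOn K f U) (t : K) :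
    IsSmoothOn K (tangentMap t f U) (tangentDomain t U) := by
  refine .prodMk (hf.comp (isSmoothOn_clm (ContinuousLinearMap.fst K V V) _) fun p hp => hp.1)
    ((hf.slope hK hU).comp (f := fun p : V × V => (p.1, p.2, t)) (.prodMk
      (isSmoothOn_clm (ContinuousLinearMap.fst K V V) _) (.prodMk
      (isSmoothOn_clm (ContinuousLinearMap.snd K V V) _) (isSmoothOn_const t _))) fun p hp => hp)

end Slope

/-! ### Cubes, their vertices, and the extended domains and maps -/

section Cube

variable {n : ℕ} {K V W X : Type u}

/-- This follows the recursion that defines `cubeDomain` and `cubeMap`, where the largest index is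
treated last. -/
theorem max_erase_induction {P : Finset (Fin n) → Prop} (h0 : P ∅)
    (hs : ∀ (A : Finset (Fin n)) (h : A.Nonempty), P (A.erase (A.max' h)) → P A)
    (A : Finset (Fin n)) : P A := by
  induction A using Finset.strongInduction with
  | H A ih =>
    rcases A.eq_empty_or_nonempty with rfl | h
    · exact h0
    · exact hs A h (ih _ (Finset.erase_ssubset (A.max'_mem h)))

theorem Cube.split_join {A : Finset (Fin n)} {k : Fin n} (hk : k ∈ A)
    (p : Cube (A.erase k) V × Cube (A.erase k) V) : Cube.split hk (Cube.join p) = p := by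
  have hB : ∀ B : {B : Finset (Fin n) // B ⊆ A.erase k}, k ∉ B.1 := fun B h =>
    Finset.notMem_erase k A (B.2 h)
  refine Prod.ext (funext fun B => ?_) (funext fun B => ?_)
  · simp [Cube.split, Cube.join, hB B]
  · simp [Cube.split, Cube.join, hB B]

theorem Cube.join_split {A : Finset (Fin n)} {k : Fin n} (hk : k ∈ A)
    (v : Cube A V) : Cube.join (Cube.split hk v) = v := by
  funext B
  by_cases h : k ∈ B.1
  · simp [Cube.split, Cube.join, h, Finset.insert_erase h]
  · simp [Cube.split, Cube.join, h]

theorem Cube.split_injective {A : Finset (Fin n)} {k : Fin n} (hk : k ∈ A) :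
    Function.Injective (Cube.split (V := V) hk) :=
  Function.LeftInverse.injective (Cube.join_split hk)

variable [CommRing K] [TopologicalSpace K]
  [AddCommGroup V] [Module K V] [TopologicalSpace V]
  [AddCommGroup W] [Module K W] [TopologicalSpace W]

instance (A : Finset (Fin n)) [ContinuousSMul K V] : ContinuousSMul K (Cube A V) :=
  inferInstanceAs (ContinuousSMul K ({B : Finset (Fin n) // B ⊆ A} → V))

instance (A : Finset (Fin n)) [T2Space V] : T2Space (Cube A V) :=
  inferInstanceAs (T2Space ({B : Finset (Fin n) // B ⊆ A} → V))

/-- Evaluation of a family at one index, as a continuous linear map. -/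
def Cube.evalL (K : Type u) {V : Type u} [CommRing K] [AddCommGroup V] [Module K V]
    [TopologicalSpace V] {A : Finset (Fin n)} (B : {B : Finset (Fin n) // B ⊆ A}) :
    Cube A V →L[K] V where
  toFun v := v B
  map_add' _ _ := rfl
  map_smul' _ _ := rfl
  cont := continuous_apply B

/-- `Cube.split` as a continuous linear map. -/
def Cube.splitL (K : Type u) {V : Type u} [CommRing K] [AddCommGroup V] [Module K V]
    [TopologicalSpace V] {A : Finset (Fin n)} {k : Fin n} (hk : k ∈ A) :
    Cube A V →L[K] Cube (A.erase k) V × Cube (A.erase k) V where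
  toFun := Cube.split hk
  map_add' _ _ := rfl
  map_smul' _ _ := rfl
  cont := (continuous_pi fun _ => continuous_apply _).prodMk
    (continuous_pi fun _ => continuous_apply _)

/-- A continuous linear map into the families given by its components. -/
def Cube.piL {A : Finset (Fin n)} (L : {B : Finset (Fin n) // B ⊆ A} → V →L[K] W) :
    V →L[K] Cube A W where
  toFun v B := L B v
  map_add' v w := funext fun B => map_add (L B) v w
  map_smul' c v := funext fun B => map_smul (L B) c v
  cont := continuous_pi fun B => (L B).continuous

/-- The continuous linear map on families induced by a continuous linear map. -/
def Cube.mapL (A : Finset (Fin n)) (L : V →L[K] W) : Cube A V →L[K] Cube A W :=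
  Cube.piL fun B => L.comp (Cube.evalL K B)

/-- `Cube.join` as a continuous linear map. -/
def Cube.joinL (K : Type u) {V : Type u} [CommRing K] [AddCommGroup V] [Module K V]
    [TopologicalSpace V] (A : Finset (Fin n)) (k : Fin n) :
    Cube (A.erase k) V × Cube (A.erase k) V →L[K] Cube A V where
  toFun := Cube.join
  map_add' p q := by
    funext B
    change Cube.join (p + q) B = Cube.join p B + Cube.join q B
    unfold Cube.join
    split_ifs <;> rfl
  map_smul' c p := by
    funext B
    change Cube.join (c • p) B = c • Cube.join p B
    unfold Cube.join
    split_ifs <;> rfl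
  cont := by
    refine continuous_pi fun B => ?_
    change Continuous fun p : Cube (A.erase k) V × Cube (A.erase k) V => Cube.join p B
    unfold Cube.join
    split_ifs with h
    · exact (continuous_apply _).comp continuous_snd
    · exact (continuous_apply _).comp continuous_fst

theorem mem_cubeDomain_empty {t : Fin n → K} {U : Set V} {v : Cube ∅ V} :
    v ∈ cubeDomain t ∅ U ↔ v ⟨∅, Finset.empty_subset ∅⟩ ∈ U := by
  rw [cubeDomain, dif_neg Finset.not_nonempty_empty]
  rfl

theorem cubeMap_empty {t : Fin n → K} {f : V → W} {U : Set V} {v : Cube ∅ V} :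
    cubeMap t ∅ f U v = fun _ => f (v ⟨∅, Finset.empty_subset ∅⟩) := by
  rw [cubeMap]
  exact congrFun (dif_neg Finset.not_nonempty_empty) v

theorem mem_cubeDomain_step {t : Fin n → K} {A : Finset (Fin n)} (h : A.Nonempty) {U : Set V}
    {v : Cube A V} : v ∈ cubeDomain t A U ↔ Cube.split (A.max'_mem h) v ∈
      tangentDomain (t (A.max' h)) (cubeDomain t (A.erase (A.max' h)) U) := by
  rw [cubeDomain, dif_pos h]
  rfl

theorem split_cubeMap {t : Fin n → K} {A : Finset (Fin n)} (h : A.Nonempty) {f : V → W}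
    {U : Set V} {v : Cube A V} : Cube.split (A.max'_mem h) (cubeMap t A f U v) =
      tangentMap (t (A.max' h)) (cubeMap t (A.erase (A.max' h)) f U)
        (cubeDomain t (A.erase (A.max' h)) U) (Cube.split (A.max'_mem h) v) := by
  rw [cubeMap]
  exact (congrArg (Cube.split (A.max'_mem h)) (congrFun (dif_pos h) v)).trans (Cube.split_join _ _)

/-- The vertex of a point of `V_t^{A;n}` belonging to the subset `S ∩ A` of `A`, that is
`∑ B ⊆ S ∩ A, t_B v_B`. -/
noncomputable def cubeVertex (t : Fin n → K) (A S : Finset (Fin n)) (v : Cube A V) : V :=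
  if h : A.Nonempty then
    cubeVertex t (A.erase (A.max' h)) S
      (if A.max' h ∈ S then (Cube.split (A.max'_mem h) v).1 +
        t (A.max' h) • (Cube.split (A.max'_mem h) v).2 else (Cube.split (A.max'_mem h) v).1)
  else v ⟨∅, Finset.empty_subset A⟩
termination_by A.card
decreasing_by exact Finset.card_erase_lt_of_mem (A.max'_mem h)

theorem cubeVertex_empty {t : Fin n → K} {S : Finset (Fin n)} {v : Cube ∅ V} :
    cubeVertex t ∅ S v = v ⟨∅, Finset.empty_subset ∅⟩ := by
  rw [cubeVertex, dif_neg Finset.not_nonempty_empty]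

theorem cubeVertex_step {t : Fin n → K} {A : Finset (Fin n)} (h : A.Nonempty)
    {S : Finset (Fin n)} {v : Cube A V} :
    cubeVertex t A S v = cubeVertex t (A.erase (A.max' h)) S
      (if A.max' h ∈ S then (Cube.split (A.max'_mem h) v).1 +
        t (A.max' h) • (Cube.split (A.max'_mem h) v).2 else (Cube.split (A.max'_mem h) v).1) := by
  rw [cubeVertex, dif_pos h]

theorem cubeVertex_congr {t : Fin n → K} {A S S' : Finset (Fin n)}
    (h : ∀ i ∈ A, i ∈ S ↔ i ∈ S') (v : Cube A V) : cubeVertex t A S v = cubeVertex t A S' v := by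
  induction A using max_erase_induction with
  | h0 => rw [cubeVertex_empty, cubeVertex_empty]
  | hs A hA ih =>
    rw [cubeVertex_step hA, cubeVertex_step hA, ih fun i hi => h i (Finset.mem_of_mem_erase hi)]
    simp only [h _ (A.max'_mem hA)]

/-- The step for `k` asks that both `x` and `x + t_k y` lie in the previous domain, and these are
the two branches in the recursion for vertices. Later arguments about domains use this vertexwise
criterion instead of the recursion. -/
theorem mem_cubeDomain_iff {t : Fin n → K} {A : Finset (Fin n)} {U : Set V} {v : Cube A V} :
    v ∈ cubeDomain t A U ↔ ∀ S, cubeVertex t A S v ∈ U := by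
  induction A using max_erase_induction with
  | h0 => simp [cubeVertex_empty, mem_cubeDomain_empty]
  | hs A hA ih =>
    rw [mem_cubeDomain_step hA]
    simp only [tangentDomain, Set.mem_ofPred_eq, ih, cubeVertex_step hA]
    constructor
    · rintro ⟨h1, h2⟩ S
      split_ifs
      · exact h2 S
      · exact h1 S
    · intro h
      constructor
      · intro S
        -- Only `S ∩ A` matters. Removing the largest index from `S`, or inserting it below, selects
        -- a branch without changing the remaining recursion.
        have := h (S.erase (A.max' hA))
        rw [if_neg (Finset.notMem_erase _ _)] at this
        rwa [cubeVertex_congr (S' := S.erase (A.max' hA))]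
        intro i hi
        simp [Finset.ne_of_mem_erase hi]
      · intro S
        have := h (insert (A.max' hA) S)
        rw [if_pos (Finset.mem_insert_self _ _)] at this
        rwa [cubeVertex_congr (S' := insert (A.max' hA) S)]
        intro i hi
        simp [Finset.ne_of_mem_erase hi]

theorem cubeDomain_mono {t : Fin n → K} {A : Finset (Fin n)} {U U' : Set V} (h : U ⊆ U') :
    cubeDomain t A U ⊆ cubeDomain t A U' := fun _ hv =>
  mem_cubeDomain_iff.2 fun S => h (mem_cubeDomain_iff.1 hv S)

theorem cubeDomain_nonempty {t : Fin n → K} {A : Finset (Fin n)} {U : Set V} (h : U.Nonempty) :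
    (cubeDomain t A U).Nonempty := by
  induction A using max_erase_induction with
  | h0 => exact ⟨fun _ => h.some, mem_cubeDomain_empty.2 h.some_mem⟩
  | hs A hA ih =>
    obtain ⟨v, hv⟩ := ih
    refine ⟨Cube.join (v, 0), (mem_cubeDomain_step hA).2 ?_⟩
    rw [Cube.split_join]
    simpa [tangentDomain] using hv

theorem continuous_cubeVertex [IsTopologicalRing K] [IsTopologicalAddGroup V] [ContinuousSMul K V]
    (t : Fin n → K) (A S : Finset (Fin n)) :
    Continuous (cubeVertex t A S : Cube A V → V) := by
  induction A using max_erase_induction with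
  | h0 => exact (continuous_apply (A := fun _ => V) _).congr fun v => cubeVertex_empty.symm
  | hs A hA ih =>
    have h1 : Continuous fun v : Cube A V => Cube.split (A.max'_mem hA) v :=
      (Cube.splitL K (A.max'_mem hA)).continuous
    refine (ih.comp ?_).congr fun v => (cubeVertex_step hA).symm
    split_ifs <;> fun_prop

variable [IsTopologicalRing K] [IsTopologicalAddGroup V] [ContinuousSMul K V]
  [IsTopologicalAddGroup W] [ContinuousSMul K W]

theorem isOpen_cubeDomain {t : Fin n → K} {A : Finset (Fin n)} {U : Set V} (hU : IsOpen U) :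
    IsOpen (cubeDomain t A U) := by
  have : cubeDomain t A U = ⋂ S, cubeVertex t A S ⁻¹' U := by
    ext v
    simp [mem_cubeDomain_iff]
  rw [this]
  exact isOpen_iInter_of_finite fun S => hU.preimage (continuous_cubeVertex t A S)

/-- Smoothness over `K` guarantees that at every stage of the recursion `slope` is a genuine
difference quotient and not its default value `0`. -/
theorem IsSmoothOn.cubeMap [T2Space W] (hK : IsGood K) (t : Fin n → K) (A : Finset (Fin n))
    {f : V → W} {U : Set V} (hU : IsOpen U) (hf : IsSmoothOn K f U) :
    IsSmoothOn K (cubeMap t A f U) (cubeDomain t A U) := by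
  induction A using max_erase_induction with
  | h0 =>
    have h := (hf.comp (isSmoothOn_clm (Cube.evalL K (V := V) (A := ∅) ⟨∅, Finset.empty_subset ∅⟩)
      (cubeDomain t ∅ U)) fun v hv => mem_cubeDomain_empty.1 hv).clm_comp
      (Cube.piL (A := (∅ : Finset (Fin n))) fun _ => ContinuousLinearMap.id K W)
    exact h.congr le_rfl fun v _ => cubeMap_empty.symm
  | hs A hA ih =>
    have h := ((ih.tangentMap hK (isOpen_cubeDomain hU) (t (A.max' hA))).comp
      (isSmoothOn_clm (Cube.splitL K (V := V) (A.max'_mem hA)) (cubeDomain t A U))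
      fun v hv => (mem_cubeDomain_step hA).1 hv).clm_comp (Cube.joinL K A (A.max' hA))
    refine h.congr le_rfl fun v _ => Cube.split_injective (A.max'_mem hA) ?_
    rw [split_cubeMap]
    exact Cube.split_join _ _

/-- One step sends `(x, y)` to `(f x, f^[1] (x, y, t))`, whose two ends are `f x` and `f x + t f^[1]
(x, y, t) = f (x + t y)`. -/
theorem cubeVertex_cubeMap [T2Space W] (hK : IsGood K) {t : Fin n → K} {A : Finset (Fin n)}
    {f : V → W} {U : Set V} (hU : IsOpen U) (hf : IsSmoothOn K f U) {v : Cube A V}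
    (hv : v ∈ cubeDomain t A U) (S : Finset (Fin n)) :
    cubeVertex t A S (cubeMap t A f U v) = f (cubeVertex t A S v) := by
  induction A using max_erase_induction with
  | h0 =>
    rw [cubeMap_empty, cubeVertex_empty]
    exact cubeVertex_empty
  | hs A hA ih =>
    rw [mem_cubeDomain_step hA] at hv
    rw [cubeVertex_step hA, cubeVertex_step hA, split_cubeMap]
    have h := (hf.cubeMap hK t (A.erase (A.max' hA)) hU).isSlope (_, _, t (A.max' hA)) hv
    split_ifs with hS
    · rw [← ih hv.2, ← sub_add_cancel (LieCalculus.cubeMap _ _ _ _ (_ + _)), h, add_comm]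
      rfl
    · exact ih hv.1

theorem mapsTo_cubeMap [T2Space W] (hK : IsGood K) {t : Fin n → K} {A : Finset (Fin n)}
    {f : V → W} {U : Set V} {U' : Set W} (hU : IsOpen U) (hf : IsSmoothOn K f U)
    (h : Set.MapsTo f U U') :
    Set.MapsTo (cubeMap t A f U) (cubeDomain t A U) (cubeDomain t A U') := fun v hv =>
  mem_cubeDomain_iff.2 fun S => by
    rw [cubeVertex_cubeMap hK hU hf hv]
    exact h (mem_cubeDomain_iff.1 hv S)

end Cube


/-! ### Functoriality, sums and products under extension -/

section Functor

variable {n : ℕ} {K V W X : Type u} [CommRing K] [TopologicalSpace K] [IsTopologicalRing K]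
  [AddCommGroup V] [Module K V] [TopologicalSpace V] [IsTopologicalAddGroup V] [ContinuousSMul K V]
  [AddCommGroup W] [Module K W] [TopologicalSpace W] [IsTopologicalAddGroup W] [ContinuousSMul K W]
  [AddCommGroup X] [Module K X] [TopologicalSpace X] [IsTopologicalAddGroup X]
  [ContinuousSMul K X] {t : Fin n → K} {A : Finset (Fin n)}

/-- The induction step for all formulas on `cubeMap`: if `G` describes the map before the last
index, any continuous difference quotient `g` of `G` must be the one used in the last step, by
uniqueness. -/
theorem split_cubeMap_eq [T2Space W] (hK : IsGood K) (hA : A.Nonempty) {f : V → W} {U : Set V}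
    (hU : IsOpen U) {G : Cube (A.erase (A.max' hA)) V → Cube (A.erase (A.max' hA)) W}
    {g : Cube (A.erase (A.max' hA)) V × Cube (A.erase (A.max' hA)) V × K →
      Cube (A.erase (A.max' hA)) W}
    (hG : Set.EqOn (cubeMap t (A.erase (A.max' hA)) f U) G (cubeDomain t (A.erase (A.max' hA)) U))
    (hg : IsSlope K G (cubeDomain t (A.erase (A.max' hA)) U) g)
    (hgc : ContinuousOn g (extDomain K (cubeDomain t (A.erase (A.max' hA)) U)))
    {v : Cube A V} (hv : v ∈ cubeDomain t A U) :
    Cube.split (A.max'_mem hA) (cubeMap t A f U v) = (G (Cube.split (A.max'_mem hA) v).1,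
      g ((Cube.split (A.max'_mem hA) v).1, (Cube.split (A.max'_mem hA) v).2, t (A.max' hA))) := by
  rw [mem_cubeDomain_step hA] at hv
  rw [split_cubeMap hA]
  exact Prod.ext (hG hv.1)
    (slope_eq hK (isOpen_cubeDomain hU) (hg.congr le_rfl hG.symm) hgc hv)

/-- The choice in `slope` depends on the domain, so compatibility with restriction is not automatic.
It comes from uniqueness, since a quotient on the larger domain restricts to one on the smaller. -/
theorem cubeMap_congr [T2Space W] (hK : IsGood K) {f f' : V → W} {U U' : Set V} (hU : IsOpen U)
    (hU' : IsOpen U') (hf : IsSmoothOn K f U) (h : U' ⊆ U) (hff : Set.EqOn f' f U') :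
    Set.EqOn (cubeMap t A f' U') (cubeMap t A f U) (cubeDomain t A U') := by
  induction A using max_erase_induction with
  | h0 =>
    intro v hv
    rw [cubeMap_empty, cubeMap_empty, hff (mem_cubeDomain_empty.1 hv)]
  | hs A hA ih =>
    intro v hv
    refine Cube.split_injective (A.max'_mem hA) ?_
    have hs := hf.cubeMap hK t (A.erase (A.max' hA)) hU
    have hsl := hs.slope hK (isOpen_cubeDomain hU)
    rw [split_cubeMap_eq hK hA hU' ih (hs.isSlope.congr (cubeDomain_mono h) fun _ _ => rfl)
      (hsl.continuousOn.mono (extDomain_mono (cubeDomain_mono h))) hv, split_cubeMap hA]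
    rfl

/-- Each step is the chain rule `(g ∘ f)^[1] (x, v, s) = g^[1] (f x, f^[1] (x, v, s), s)`, taken at
`s = t_k`. -/
theorem cubeMap_comp [T2Space W] [T2Space X] (hK : IsGood K) {f : V → W} {U : Set V} {g : W → X}
    {U' : Set W} (hU : IsOpen U) (hU' : IsOpen U') (hf : IsSmoothOn K f U)
    (hg : IsSmoothOn K g U') (h : Set.MapsTo f U U') :
    Set.EqOn (cubeMap t A (fun x => g (f x)) U) (fun v => cubeMap t A g U' (cubeMap t A f U v))
      (cubeDomain t A U) := by
  induction A using max_erase_induction with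
  | h0 =>
    intro v _
    simp only [cubeMap_empty]
    exact (cubeMap_empty (f := g) (U := U') (v := fun _ => f (v ⟨∅, _⟩))).symm
  | hs A hA ih =>
    intro v hv
    refine Cube.split_injective (A.max'_mem hA) ?_
    have hs := hf.cubeMap hK t (A.erase (A.max' hA)) hU
    have hs' := hg.cubeMap hK t (A.erase (A.max' hA)) hU'
    obtain ⟨hc, hm⟩ := hs'.isSlope.comp hs.isSlope (mapsTo_cubeMap hK hU hf h)
    rw [split_cubeMap_eq hK hA hU ih hc ?_ hv, split_cubeMap hA, split_cubeMap hA]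
    · rfl
    · refine (hs'.slope hK (isOpen_cubeDomain hU')).continuousOn.comp ?_ hm
      exact (hs.continuousOn.comp continuousOn_fst fun p hp => hp.1).prodMk
        ((hs.slope hK (isOpen_cubeDomain hU)).continuousOn.prodMk (by fun_prop))

theorem cubeMap_add [T2Space W] (hK : IsGood K) {f g : V → W} {U : Set V}
    (hU : IsOpen U) (hf : IsSmoothOn K f U) (hg : IsSmoothOn K g U) :
    Set.EqOn (cubeMap t A (fun x => f x + g x) U) (fun v => cubeMap t A f U v + cubeMap t A g U v)
      (cubeDomain t A U) := by
  induction A using max_erase_induction with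
  | h0 =>
    intro v _
    simp only [cubeMap_empty]
    rfl
  | hs A hA ih =>
    intro v hv
    refine Cube.split_injective (A.max'_mem hA) ?_
    have hs := hf.cubeMap hK t (A.erase (A.max' hA)) hU
    have hs' := hg.cubeMap hK t (A.erase (A.max' hA)) hU
    change _ = Cube.split (A.max'_mem hA) (cubeMap t A f U v) +
      Cube.split (A.max'_mem hA) (cubeMap t A g U v)
    rw [split_cubeMap_eq hK hA hU ih
      (g := fun p => slope K (cubeMap t (A.erase (A.max' hA)) f U) _ p +
        slope K (cubeMap t (A.erase (A.max' hA)) g U) _ p) ?_ ?_ hv,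
      split_cubeMap hA, split_cubeMap hA]
    · rfl
    · intro p hp
      rw [smul_add, ← hs.isSlope p hp, ← hs'.isSlope p hp]
      exact add_sub_add_comm _ _ _ _
    · exact (hs.slope hK (isOpen_cubeDomain hU)).continuousOn.add
        (hs'.slope hK (isOpen_cubeDomain hU)).continuousOn

theorem cubeMap_clm [T2Space W] (hK : IsGood K) (L : V →L[K] W) {U : Set V} (hU : IsOpen U) :
    Set.EqOn (cubeMap t A L U) (Cube.mapL A L) (cubeDomain t A U) := by
  induction A using max_erase_induction with
  | h0 =>
    intro v hv
    rw [cubeMap_empty]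
    funext B
    obtain ⟨B, hB⟩ := B
    obtain rfl := Finset.subset_empty.1 hB
    rfl
  | hs A hA ih =>
    intro v hv
    refine Cube.split_injective (A.max'_mem hA) ?_
    rw [split_cubeMap_eq hK hA hU ih (isSlope_clm (Cube.mapL _ L) _)
      ((Cube.mapL _ L).continuous.comp_continuousOn (by fun_prop)) hv]
    rfl

theorem cubeMul_smul_left (c : K) (a : Cube A K) (v : Cube A V) :
    cubeMul t (c • a) v = c • cubeMul t a v := by
  funext D
  change _ = c • cubeMul t a v D
  simp only [cubeMul, Finset.smul_sum]
  refine Finset.sum_congr rfl fun B _ => Finset.sum_congr rfl fun C _ => ?_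
  have : (c • a) B = c * a B := rfl
  split_ifs
  · rw [this, smul_smul]
    ring_nf
  · simp

theorem cubeMul_smul_right (c : K) (a : Cube A K) (v : Cube A V) :
    cubeMul t a (c • v) = c • cubeMul t a v := by
  funext D
  change _ = c • cubeMul t a v D
  simp only [cubeMul, Finset.smul_sum]
  refine Finset.sum_congr rfl fun B _ => Finset.sum_congr rfl fun C _ => ?_
  have : (c • v) C = c • v C := rfl
  split_ifs
  · rw [this, smul_comm]
  · simp

theorem smul_cubeSingle (c : K) (B : {B : Finset (Fin n) // B ⊆ A}) (x : V) :
    c • cubeSingle B x = cubeSingle B (c • x) := by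
  funext D
  change c • cubeSingle B x D = _
  simp only [cubeSingle]
  split_ifs <;> simp

theorem cubeSingle_congr {B B' : {B : Finset (Fin n) // B ⊆ A}} {x x' : V} (h : B.1 = B'.1)
    (hx : x = x') : cubeSingle B x = cubeSingle B' x' := by
  rw [Subtype.ext h, hx]

theorem split_cubeSingle_of_mem {k : Fin n} (hk : k ∈ A) {B : {B : Finset (Fin n) // B ⊆ A}}
    (hB : k ∈ B.1) (x : V) : Cube.split hk (cubeSingle B x) =
      (0, cubeSingle ⟨B.1.erase k, Finset.erase_subset_erase k B.2⟩ x) := by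
  refine Prod.ext (funext fun D => ?_) (funext fun D => ?_)
  · refine if_neg fun h => ?_
    subst h
    exact Finset.notMem_erase k A (D.2 hB)
  · have hD : k ∉ D.1 := fun h => Finset.notMem_erase k A (D.2 h)
    simp only [Cube.split, cubeSingle, Subtype.ext_iff]
    congr 1
    refine propext ⟨fun h => ?_, fun h => ?_⟩
    · rw [h, Finset.erase_insert hD]
    · rw [← h, Finset.insert_erase hB]

theorem split_cubeSingle_of_notMem {k : Fin n} (hk : k ∈ A) {B : {B : Finset (Fin n) // B ⊆ A}}
    (hB : k ∉ B.1) (x : V) : Cube.split hk (cubeSingle B x) =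
      (cubeSingle ⟨B.1, Finset.subset_erase.2 ⟨B.2, hB⟩⟩ x, 0) := by
  refine Prod.ext (funext fun D => ?_) (funext fun D => ?_)
  · simp only [Cube.split, cubeSingle, Subtype.ext_iff]
  · refine if_neg fun h => ?_
    rw [h] at hB
    exact hB (Finset.mem_insert_self _ _)

/-- The product of `x + x' e_k` and `y + y' e_k` is `x y + (x' y + x y' + t_k x' y') e_k`. -/
theorem split_cubeMul {k : Fin n} (hk : k ∈ A) (a : Cube A K) (v : Cube A V) :
    Cube.split hk (cubeMul t a v) =
      (cubeMul t (Cube.split hk a).1 (Cube.split hk v).1,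
        cubeMul t (Cube.split hk a).2 (Cube.split hk v).1 +
          (cubeMul t (Cube.split hk a).1 (Cube.split hk v).2 +
            t k • cubeMul t (Cube.split hk a).2 (Cube.split hk v).2)) := by
  have hadd : ∀ {Y : Type u} [AddCommGroup Y] (x y : Cube A Y),
      Cube.split hk (x + y) = Cube.split hk x + Cube.split hk y := fun _ _ => rfl
  have hzero : ∀ {Y : Type u} [AddCommGroup Y], Cube.split hk (0 : Cube A Y) = 0 := rfl
  induction a using cube_induction with
  | h0 => simp [cubeMul_zero_left, hzero, Prod.ext_iff]
  | hadd a a' h h' =>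
    rw [cubeMul_add_left, hadd, h, h', hadd]
    simp only [Prod.fst_add, Prod.snd_add, cubeMul_add_left, Prod.mk_add_mk, smul_add]
    congr 1
    abel
  | hs B x =>
    induction v using cube_induction with
    | h0 => simp [cubeMul_zero_right, hzero, Prod.ext_iff]
    | hadd v v' h h' =>
      rw [cubeMul_add_right, hadd, h, h', hadd]
      simp only [Prod.fst_add, Prod.snd_add, cubeMul_add_right, Prod.mk_add_mk, smul_add]
      congr 1
      abel
    | hs C y =>
      rw [cubeMul_single]
      by_cases hB : k ∈ B.1 <;> by_cases hC : k ∈ C.1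
      · rw [split_cubeSingle_of_mem hk (by simp [hB]), split_cubeSingle_of_mem hk hB,
          split_cubeSingle_of_mem hk hC]
        simp only [cubeMul_zero_left, cubeMul_zero_right, zero_add, cubeMul_single,
          smul_cubeSingle]
        refine Prod.ext rfl (cubeSingle_congr (Finset.erase_union_distrib _ _ _) ?_)
        have : B.1.erase k ∩ C.1.erase k = (B.1 ∩ C.1).erase k := by grind
        rw [this, smul_smul, ← mul_assoc,
          Finset.mul_prod_erase _ _ (Finset.mem_inter.2 ⟨hB, hC⟩)]
      · rw [split_cubeSingle_of_mem hk (by simp [hB]), split_cubeSingle_of_mem hk hB,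
          split_cubeSingle_of_notMem hk hC]
        simp only [cubeMul_zero_left, cubeMul_zero_right, add_zero, smul_zero,
          cubeMul_single]
        refine Prod.ext rfl (cubeSingle_congr ?_ ?_)
        · simp [Finset.erase_union_distrib, Finset.erase_eq_of_notMem hC]
        · have : B.1.erase k ∩ C.1 = B.1 ∩ C.1 := by grind
          simp [this]
      · rw [split_cubeSingle_of_mem hk (by simp [hC]), split_cubeSingle_of_notMem hk hB,
          split_cubeSingle_of_mem hk hC]
        simp only [cubeMul_zero_left, cubeMul_zero_right, add_zero, zero_add, smul_zero,
          cubeMul_single]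
        refine Prod.ext rfl (cubeSingle_congr ?_ ?_)
        · simp [Finset.erase_union_distrib, Finset.erase_eq_of_notMem hB]
        · have : B.1 ∩ C.1.erase k = B.1 ∩ C.1 := by grind
          simp [this]
      · rw [split_cubeSingle_of_notMem hk (by simp [hB, hC]), split_cubeSingle_of_notMem hk hB,
          split_cubeSingle_of_notMem hk hC]
        simp only [cubeMul_zero_left, cubeMul_zero_right, add_zero, smul_zero, cubeMul_single]

/-- The product rule, with its second-order term kept. At the scalar `t k` its three terms are those
of the `e_k`-component in `split_cubeMul`. -/
theorem isSlope_cubeMul (L : V →L[K] Cube A K) {H : V → Cube A W} {U : Set V}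
    {g : V × V × K → Cube A W} (hg : IsSlope K H U g) :
    IsSlope K (fun v => cubeMul t (L v) (H v)) U (fun p => cubeMul t (L p.2.1) (H p.1) +
      (cubeMul t (L p.1) (g p) + p.2.2 • cubeMul t (L p.2.1) (g p))) := by
  intro p hp
  have e := hg p hp
  rw [sub_eq_iff_eq_add] at e
  simp only [e, map_add, map_smul, cubeMul_add_left, cubeMul_add_right, cubeMul_smul_left,
    cubeMul_smul_right]
  module

theorem continuousOn_cubeMul {Y : Type u} [TopologicalSpace Y] {a : Y → Cube A K}
    {b : Y → Cube A W} {D : Set Y} (ha : ContinuousOn a D) (hb : ContinuousOn b D) :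
    ContinuousOn (fun p => cubeMul t (a p) (b p)) D := by
  have h := continuous_cubeMul (K := K) (V := W) t A
  have h' := h.comp_continuousOn (ha.prodMk hb)
  exact h'

theorem continuousOn_slope_cubeMul (L : V →L[K] Cube A K) {H : V → Cube A W} {U : Set V}
    {g : V × V × K → Cube A W} (hH : ContinuousOn H U) (hg : ContinuousOn g (extDomain K U)) :
    ContinuousOn (fun p => cubeMul t (L p.2.1) (H p.1) +
      (cubeMul t (L p.1) (g p) + p.2.2 • cubeMul t (L p.2.1) (g p))) (extDomain K U) := by
  have h0 := hH.comp (continuousOn_fst (s := extDomain K U)) fun p hp => hp.1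
  have h1 : ContinuousOn (fun p : V × V × K => L p.1) (extDomain K U) :=
    (L.continuous.comp continuous_fst).continuousOn
  have h2 : ContinuousOn (fun p : V × V × K => L p.2.1) (extDomain K U) :=
    (L.continuous.comp (continuous_fst.comp continuous_snd)).continuousOn
  exact (continuousOn_cubeMul h2 h0).add ((continuousOn_cubeMul h1 hg).add
    (ContinuousOn.smul (continuous_snd.comp continuous_snd).continuousOn (continuousOn_cubeMul h2 hg)))

theorem cubeMul_empty (a : Cube (∅ : Finset (Fin n)) K) (v : Cube ∅ V)
    (D : {B : Finset (Fin n) // B ⊆ ∅}) :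
    cubeMul t a v D = a ⟨∅, Finset.empty_subset ∅⟩ • v ⟨∅, Finset.empty_subset ∅⟩ := by
  obtain ⟨D, hD⟩ := D
  obtain rfl := Finset.subset_empty.1 hD
  simp only [cubeMul]
  rw [Fintype.sum_eq_single ⟨∅, hD⟩, Fintype.sum_eq_single ⟨∅, hD⟩]
  · simp
  · rintro ⟨C, hC⟩ h
    exact absurd (Subtype.ext (Finset.subset_empty.1 hC)) h
  · rintro ⟨C, hC⟩ h
    exact absurd (Subtype.ext (Finset.subset_empty.1 hC)) h

/-- Here the ring structure enters: the product rule for the step `k` is multiplication with `e_k ^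
2 = t_k e_k`. A linear `L` suffices because the scalar to be extended later is the projection `(x,
v, s) ↦ s`. -/
theorem cubeMap_smul [T2Space W] (hK : IsGood K) (L : V →L[K] K) {h : V → W} {U : Set V}
    (hU : IsOpen U) (hh : IsSmoothOn K h U) :
    Set.EqOn (cubeMap t A (fun x => L x • h x) U)
      (fun v => cubeMul t (Cube.mapL A L v) (cubeMap t A h U v)) (cubeDomain t A U) := by
  induction A using max_erase_induction with
  | h0 =>
    intro v hv
    simp only [cubeMap_empty]
    funext B
    exact (cubeMul_empty (Cube.mapL ∅ L v) (fun _ => h (v ⟨∅, _⟩) : Cube ∅ W) B).symm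
  | hs A hA ih =>
    intro v hv
    refine Cube.split_injective (A.max'_mem hA) ?_
    have hs := hh.cubeMap hK t (A.erase (A.max' hA)) hU
    have hsl := (hs.slope hK (isOpen_cubeDomain hU)).continuousOn
    rw [split_cubeMul, split_cubeMap_eq hK hA hU ih
      (isSlope_cubeMul (Cube.mapL (A.erase (A.max' hA)) L) hs.isSlope)
      (continuousOn_slope_cubeMul _ hs.continuousOn hsl) hv, split_cubeMap hA]
    rfl

end Functor


/-! ### Smoothness over the vertex ring -/

section ScalarExtension

variable {n : ℕ} {K V W X : Type u} [CommRing K] [TopologicalSpace K] [IsTopologicalRing K]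
  [AddCommGroup V] [Module K V] [TopologicalSpace V] [IsTopologicalAddGroup V] [ContinuousSMul K V]
  [AddCommGroup W] [Module K W] [TopologicalSpace W] [IsTopologicalAddGroup W] [ContinuousSMul K W]
  [AddCommGroup X] [Module K X] [TopologicalSpace X] [IsTopologicalAddGroup X]
  [ContinuousSMul K X] {t : Fin n → K} {A : Finset (Fin n)}

theorem cubeVertex_mapL (L : V →L[K] W) (S : Finset (Fin n)) (v : Cube A V) :
    cubeVertex t A S (Cube.mapL A L v) = L (cubeVertex t A S v) := by
  induction A using max_erase_induction with
  | h0 =>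
    rw [cubeVertex_empty, cubeVertex_empty]
    rfl
  | hs A hA ih =>
    rw [cubeVertex_step hA, cubeVertex_step hA, ← ih]
    congr 1
    split_ifs
    · rw [map_add, map_smul]
      rfl
    · rfl

/-- The extension of the map `x ↦ L₁ x + L₃ x • L₂ x`. -/
noncomputable def cubeLine (t : Fin n → K) (A : Finset (Fin n)) (L₁ L₂ : X →L[K] V)
    (L₃ : X →L[K] K) (z : Cube A X) : Cube A V :=
  Cube.mapL A L₁ z + cubeMul t (Cube.mapL A L₃ z) (Cube.mapL A L₂ z)

/-- The difference quotient of `cubeLine`. -/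
noncomputable def cubeLineSlope (t : Fin n → K) (A : Finset (Fin n)) (L₁ L₂ : X →L[K] V)
    (L₃ : X →L[K] K) (p : Cube A X × Cube A X × K) : Cube A V :=
  Cube.mapL A L₁ p.2.1 + (cubeMul t (Cube.mapL A L₃ p.2.1) (Cube.mapL A L₂ p.1) +
    (cubeMul t (Cube.mapL A L₃ p.1) (Cube.mapL A L₂ p.2.1) +
      p.2.2 • cubeMul t (Cube.mapL A L₃ p.2.1) (Cube.mapL A L₂ p.2.1)))

variable (L₁ L₂ : X →L[K] V) (L₃ : X →L[K] K)

theorem isSlope_cubeLine (U : Set (Cube A X)) :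
    IsSlope K (cubeLine t A L₁ L₂ L₃) U (cubeLineSlope t A L₁ L₂ L₃) := by
  intro p hp
  have h1 := isSlope_clm (Cube.mapL A L₁) U p hp
  have h2 := isSlope_cubeMul (t := t) (Cube.mapL A L₃) (isSlope_clm (Cube.mapL A L₂) U) p hp
  rw [cubeLineSlope, smul_add, ← h1, ← h2]
  exact add_sub_add_comm _ _ _ _

theorem continuous_cubeLine : Continuous (cubeLine t A L₁ L₂ L₃) := by
  rw [← continuousOn_univ]
  exact (Cube.mapL A L₁).continuous.continuousOn.add (continuousOn_cubeMul
    (Cube.mapL A L₃).continuous.continuousOn (Cube.mapL A L₂).continuous.continuousOn)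

theorem continuous_cubeLineSlope : Continuous (cubeLineSlope t A L₁ L₂ L₃) := by
  have h := continuousOn_slope_cubeMul (t := t) (U := Set.univ) (Cube.mapL A L₃)
    (Cube.mapL A L₂).continuous.continuousOn (g := fun p => Cube.mapL A L₂ p.2.1)
    ((Cube.mapL A L₂).continuous.comp (continuous_fst.comp continuous_snd)).continuousOn
  have e : extDomain K (Set.univ : Set (Cube A X)) = Set.univ :=
    Set.eq_univ_of_forall fun p => ⟨trivial, trivial⟩
  rw [e, continuousOn_univ] at h
  exact ((Cube.mapL A L₁).continuous.comp (continuous_fst.comp continuous_snd)).add h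

theorem split_cubeLine {k : Fin n} (hk : k ∈ A) (z : Cube A X) :
    Cube.split hk (cubeLine t A L₁ L₂ L₃ z) =
      (cubeLine t (A.erase k) L₁ L₂ L₃ (Cube.split hk z).1,
        cubeLineSlope t (A.erase k) L₁ L₂ L₃ ((Cube.split hk z).1, (Cube.split hk z).2, t k)) := by
  change Cube.split hk (Cube.mapL A L₁ z) + Cube.split hk (cubeMul t _ _) = _
  rw [split_cubeMul]
  rfl

theorem cubeVertex_cubeLine (S : Finset (Fin n)) (z : Cube A X) :
    cubeVertex t A S (cubeLine t A L₁ L₂ L₃ z) =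
      L₁ (cubeVertex t A S z) + L₃ (cubeVertex t A S z) • L₂ (cubeVertex t A S z) := by
  induction A using max_erase_induction with
  | h0 =>
    rw [cubeVertex_empty, cubeVertex_empty]
    change Cube.mapL ∅ L₁ z _ + cubeMul t (Cube.mapL ∅ L₃ z) (Cube.mapL ∅ L₂ z) _ = _
    rw [cubeMul_empty]
    rfl
  | hs A hA ih =>
    rw [cubeVertex_step hA, cubeVertex_step hA, ← ih, split_cubeLine]
    congr 1
    split_ifs
    · have := isSlope_cubeLine (t := t) L₁ L₂ L₃ Set.univ ((Cube.split (A.max'_mem hA) z).1,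
        (Cube.split (A.max'_mem hA) z).2, t (A.max' hA)) ⟨trivial, trivial⟩
      rw [← this]
      exact add_sub_cancel _ _
    · rfl

/-- For the three projections of `V × V × K`, the argument `cubeLine` is `x + s v` computed over the
vertex ring. For `L₂ = L₃ = 0` this is composition with a linear map. -/
theorem cubeMap_comp_line [T2Space W] (hK : IsGood K) {f : V → W} {U : Set V} {D : Set X}
    (hU : IsOpen U) (hD : IsOpen D) (hf : IsSmoothOn K f U)
    (h : ∀ x ∈ D, L₁ x + L₃ x • L₂ x ∈ U) :
    Set.EqOn (cubeMap t A (fun x => f (L₁ x + L₃ x • L₂ x)) D)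
      (fun z => cubeMap t A f U (cubeLine t A L₁ L₂ L₃ z)) (cubeDomain t A D) := by
  induction A using max_erase_induction with
  | h0 =>
    intro z hz
    simp only [cubeMap_empty]
    funext B
    change _ = f (Cube.mapL ∅ L₁ z _ + cubeMul t (Cube.mapL ∅ L₃ z) (Cube.mapL ∅ L₂ z) _)
    rw [cubeMul_empty]
    rfl
  | hs A hA ih =>
    intro z hz
    refine Cube.split_injective (A.max'_mem hA) ?_
    have hs := hf.cubeMap hK t (A.erase (A.max' hA)) hU
    have hm : Set.MapsTo (cubeLine t (A.erase (A.max' hA)) L₁ L₂ L₃)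
        (cubeDomain t (A.erase (A.max' hA)) D) (cubeDomain t (A.erase (A.max' hA)) U) :=
      fun y hy => mem_cubeDomain_iff.2 fun S => by
        rw [cubeVertex_cubeLine]
        exact h _ (mem_cubeDomain_iff.1 hy S)
    obtain ⟨hc, hm'⟩ := hs.isSlope.comp
      (isSlope_cubeLine (t := t) L₁ L₂ L₃ (cubeDomain t (A.erase (A.max' hA)) D)) hm
    rw [split_cubeMap_eq hK hA hD ih hc ?_ hz, split_cubeMap hA, split_cubeLine]
    · rfl
    · refine (hs.slope hK (isOpen_cubeDomain hU)).continuousOn.comp ?_ hm'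
      exact ((continuous_cubeLine L₁ L₂ L₃).comp continuous_fst).continuousOn.prodMk
        ((continuous_cubeLineSlope L₁ L₂ L₃).continuousOn.prodMk
          (continuous_snd.comp continuous_snd).continuousOn)

theorem cubeMap_comp_clm [T2Space W] (hK : IsGood K) (L : X →L[K] V) {f : V → W} {U : Set V}
    {D : Set X} (hU : IsOpen U) (hD : IsOpen D) (hf : IsSmoothOn K f U) (h : Set.MapsTo L D U) :
    Set.EqOn (cubeMap t A (fun x => f (L x)) D)
      (fun z => cubeMap t A f U (Cube.mapL A L z)) (cubeDomain t A D) := by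
  have h := cubeMap_comp_line (t := t) (A := A) L (0 : X →L[K] V) (0 : X →L[K] K) hK hU hD hf
    (fun x hx => by simpa using h hx)
  have e : cubeLine t A L (0 : X →L[K] V) (0 : X →L[K] K) = Cube.mapL A L := by
    funext z
    have : Cube.mapL A (0 : X →L[K] K) z = 0 := rfl
    rw [cubeLine, this, cubeMul_zero_left, add_zero]
  rw [e] at h
  simpa using h

theorem mapL_cubeMul (L : V →L[K] W) (a : Cube A K) (v : Cube A V) :
    Cube.mapL A L (cubeMul t a v) = cubeMul t a (Cube.mapL A L v) := by
  funext D
  change L (cubeMul t a v D) = _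
  simp only [cubeMul, map_sum]
  refine Finset.sum_congr rfl fun B _ => Finset.sum_congr rfl fun C _ => ?_
  split_ifs
  · rw [map_smul]
    rfl
  · exact map_zero L

/-- The identification of `V_t^{A;n} × V_t^{A;n} × K_t^{A;n}` with `(V × V × K)_t^{A;n}`. -/
def cubeProd {K : Type u} [CommRing K] [TopologicalSpace K] [IsTopologicalRing K] (V : Type u)
    [AddCommGroup V] [Module K V] [TopologicalSpace V] [IsTopologicalAddGroup V]
    [ContinuousSMul K V] (t : Fin n → K) (A : Finset (Fin n)) :
    Cube A V × Cube A V × VertexRing t A →L[VertexRing t A] Cube A (V × V × K) where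
  toFun p B := (p.1 B, p.2.1 B, p.2.2 B)
  map_add' _ _ := rfl
  map_smul' a p := by
    let J : Cube A V × Cube A V × VertexRing t A → Cube A (V × V × K) :=
      fun p B => (p.1 B, p.2.1 B, p.2.2 B)
    change J (a • p) = cubeMul t a (J p)
    have h1 := mapL_cubeMul (t := t) (ContinuousLinearMap.fst K V (V × K)) a (J p)
    have h2 := mapL_cubeMul (t := t) ((ContinuousLinearMap.fst K V K).comp
      (ContinuousLinearMap.snd K V (V × K))) a (J p)
    have h3 := mapL_cubeMul (t := t) ((ContinuousLinearMap.snd K V K).comp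
      (ContinuousLinearMap.snd K V (V × K))) a (J p)
    exact funext fun B => Prod.ext (congrFun h1 B).symm
      (Prod.ext (congrFun h2 B).symm (congrFun h3 B).symm)
  cont := continuous_pi fun B => ((continuous_apply B).comp continuous_fst).prodMk
    (((continuous_apply B).comp (continuous_fst.comp continuous_snd)).prodMk
      ((continuous_apply B).comp (continuous_snd.comp continuous_snd)))

/-- The scalar extension of a smooth map is smooth over the vertex ring. -/
theorem IsSmoothOn.cubeMap_vertexRing [T2Space W] (hK : IsGood K) (t : Fin n → K)
    (A : Finset (Fin n)) {f : V → W} {U : Set V} (hU : IsOpen U) (hf : IsSmoothOn K f U) :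
    IsSmoothOn (VertexRing t A) (LieCalculus.cubeMap t A f U) (cubeDomain t A U) := by
  intro m
  induction m generalizing V with
  | zero => exact (hf.cubeMap hK t A hU).continuousOn
  | succ m ih =>
    have hg := hf.slope hK hU
    have hO : IsOpen (extDomain K U) := isOpen_extDomain hU
    let P₁ := ContinuousLinearMap.fst K V (V × K)
    let P₂ := (ContinuousLinearMap.fst K V K).comp (ContinuousLinearMap.snd K V (V × K))
    let P₃ := (ContinuousLinearMap.snd K V K).comp (ContinuousLinearMap.snd K V (V × K))
    -- At each vertex the scalar `s` of the vertex ring becomes a scalar of `K`, and `x + s v`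
    -- becomes the same expression in the vertices. The condition can thus be checked vertex by
    -- vertex.
    have hJ : ∀ p ∈ extDomain (VertexRing t A) (cubeDomain t A U),
        cubeProd V t A p ∈ cubeDomain t A (extDomain K U) := by
      intro p hp
      refine mem_cubeDomain_iff.2 fun S => ⟨?_, ?_⟩
      · have h := mem_cubeDomain_iff.1 hp.1 S
        have e := cubeVertex_mapL (t := t) P₁ S (cubeProd V t A p)
        exact (show P₁ (cubeVertex t A S (cubeProd V t A p)) ∈ U from Eq.subst (motive := (· ∈ U)) e h)
      · have h := mem_cubeDomain_iff.1 hp.2 S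
        exact Eq.subst (motive := (· ∈ U))
          (cubeVertex_cubeLine (t := t) P₁ P₂ P₃ S (cubeProd V t A p)) h
    -- The quotient over the vertex ring is the extension of the quotient over `K`. The latter is
    -- smooth on an open subset of `V × V × K`, so the induction hypothesis applies with this module
    -- in place of `V`.
    refine ⟨fun p => LieCalculus.cubeMap t A (LieCalculus.slope K f U) (extDomain K U) (cubeProd V t A p),
      ?_, ((ih hO hg).comp_clm (cubeProd V t A)).mono hJ⟩
    intro p hp
    have hz := hJ p hp
    -- The identity `f (x + s v) = f x + s f^[1] (x, v, s)` between maps on `U^[1]` is extended term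
    -- by term.
    have h1 := cubeMap_comp_line (t := t) (A := A) P₁ P₂ P₃ hK hU hO hf (fun x hx => hx.2) hz
    have h2 := cubeMap_comp_clm (t := t) (A := A) hK P₁ hU hO hf (fun x hx => hx.1) hz
    have hf₁ : IsSmoothOn K (fun x : V × V × K => f (P₁ x)) (extDomain K U) :=
      hf.comp (isSmoothOn_clm P₁ _) fun x hx => hx.1
    have h3 := cubeMap_add (t := t) (A := A) hK hO hf₁ ((isSmoothOn_clm P₃ _).smul hg) hz
    have h4 := cubeMap_smul (t := t) (A := A) hK P₃ hO hg hz
    have h5 : Set.EqOn (fun x : V × V × K => f (P₁ x + P₃ x • P₂ x))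
        (fun x => f (P₁ x) + P₃ x • LieCalculus.slope K f U x) (extDomain K U) := fun x hx =>
      sub_eq_iff_eq_add'.1 (hf.isSlope x hx)
    have h6 := cubeMap_congr (t := t) (A := A) hK hO hO
      (hf₁.add ((isSmoothOn_clm P₃ _).smul hg)) le_rfl h5 hz
    simp only at h1 h2 h3 h4
    rw [h1, h3, h2, h4] at h6
    exact sub_eq_iff_eq_add'.2 h6

end ScalarExtension


/-! ### Extended chart expressions -/

section Charts

variable {n : ℕ} {K V W X : Type u} [CommRing K] [TopologicalSpace K] [IsTopologicalRing K]
  [AddCommGroup V] [Module K V] [TopologicalSpace V] [IsTopologicalAddGroup V] [ContinuousSMul K V]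
  [AddCommGroup W] [Module K W] [TopologicalSpace W] [IsTopologicalAddGroup W] [ContinuousSMul K W]
  [AddCommGroup X] [Module K X] [TopologicalSpace X] [IsTopologicalAddGroup X]
  [ContinuousSMul K X] {t : Fin n → K} {A : Finset (Fin n)}
  {M N P : Type*} [TopologicalSpace M] [TopologicalSpace N] [TopologicalSpace P]

/-- A topological group with a nonempty open subset homeomorphic to an open subset of a Hausdorff
space is Hausdorff. -/
theorem t2Space_of_chart [T2Space M] (c : OpenPartialHomeomorph M V) (h : c.target.Nonempty) :
    T2Space V := by
  obtain ⟨x₀, h₀⟩ := h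
  have : T0Space V := by
    refine ⟨fun x y hxy => ?_⟩
    -- Translation carries an inseparable pair into the image of the chart. Its preimage is an
    -- inseparable pair in the Hausdorff space `M`, hence a single point. A topological group that
    -- is `T0` is Hausdorff.
    have h1 : Inseparable x₀ (x₀ + (y - x)) := by
      have := hxy.map (f := fun z : V => x₀ + (z - x)) (by fun_prop)
      simpa using this
    have h2 : x₀ + (y - x) ∈ c.target := (h1.mem_open_iff c.open_target).1 h₀
    have h3 : Inseparable (c.symm x₀) (c.symm (x₀ + (y - x))) := by
      refine inseparable_iff_forall_isOpen.2 fun O hO => ?_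
      have := h1.mem_open_iff (c.isOpen_inter_preimage_symm hO)
      simpa [h₀, h2] using this
    have h4 := c.symm.injOn h₀ h2 h3.eq
    exact (sub_eq_zero.1 (left_eq_add.1 h4)).symm
  infer_instance

theorem isOpen_exprDomain (c : OpenPartialHomeomorph M V) (d : OpenPartialHomeomorph N W)
    {f : M → N} (hf : Continuous f) : IsOpen (exprDomain c d f) :=
  c.isOpen_inter_preimage_symm (d.open_source.preimage hf)

/-- The scalar extension of the chart expression `d ∘ f ∘ c⁻¹`. -/
noncomputable def cubeExpr (t : Fin n → K) (A : Finset (Fin n)) (c : OpenPartialHomeomorph M V)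
    (d : OpenPartialHomeomorph N W) (f : M → N) : Cube A V → Cube A W :=
  cubeMap t A (d ∘ f ∘ c.symm) (exprDomain c d f)

theorem mem_cubeDomain_exprDomain {c : OpenPartialHomeomorph M V}
    {d : OpenPartialHomeomorph N W} {f : M → N} {z : Cube A V} :
    z ∈ cubeDomain t A (exprDomain c d f) ↔
      z ∈ cubeDomain t A c.target ∧ ∀ S, f (c.symm (cubeVertex t A S z)) ∈ d.source := by
  simp only [mem_cubeDomain_iff, exprDomain, Set.mem_inter_iff, Set.mem_preimage, forall_and]

/-- Read in the manifolds, the action on vertices is `f` itself and no longer involves the charts.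
-/
theorem symm_cubeVertex_cubeExpr [T2Space W] (hK : IsGood K) {c : OpenPartialHomeomorph M V}
    {d : OpenPartialHomeomorph N W} {f : M → N} (hfc : Continuous f)
    (hf : IsSmoothOn K (d ∘ f ∘ c.symm) (exprDomain c d f)) {z : Cube A V}
    (hz : z ∈ cubeDomain t A (exprDomain c d f)) (S : Finset (Fin n)) :
    d.symm (cubeVertex t A S (cubeExpr t A c d f z)) = f (c.symm (cubeVertex t A S z)) := by
  rw [cubeExpr, cubeVertex_cubeMap hK (isOpen_exprDomain c d hfc) hf hz]
  exact d.left_inv ((mem_cubeDomain_exprDomain.1 hz).2 S)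

theorem cubeExpr_mem [T2Space W] (hK : IsGood K) {c : OpenPartialHomeomorph M V}
    {d : OpenPartialHomeomorph N W} {f : M → N} (hfc : Continuous f)
    (hf : IsSmoothOn K (d ∘ f ∘ c.symm) (exprDomain c d f)) {z : Cube A V}
    (hz : z ∈ cubeDomain t A (exprDomain c d f)) :
    cubeExpr t A c d f z ∈ cubeDomain t A d.target :=
  mapsTo_cubeMap hK (isOpen_exprDomain c d hfc) hf (fun _ hx => d.map_source hx.2) hz

/-- Neither of the domains for `f` and `g ∘ f` need contain the other. The chain rule is applied on
their intersection, to which the point belongs by the vertex criterion, and `cubeMap_congr` leads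
back to the original domains. -/
theorem cubeExpr_comp [T2Space W] [T2Space X] (hK : IsGood K) {c : OpenPartialHomeomorph M V}
    {d : OpenPartialHomeomorph N W} {e : OpenPartialHomeomorph P X} {f : M → N} {g : N → P}
    (hfc : Continuous f) (hgc : Continuous g)
    (hf : IsSmoothOn K (d ∘ f ∘ c.symm) (exprDomain c d f))
    (hg : IsSmoothOn K (e ∘ g ∘ d.symm) (exprDomain d e g))
    (hgf : IsSmoothOn K (e ∘ (g ∘ f) ∘ c.symm) (exprDomain c e (g ∘ f))) {z : Cube A V}
    (hz : z ∈ cubeDomain t A (exprDomain c d f))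
    (hz' : z ∈ cubeDomain t A (exprDomain c e (g ∘ f))) :
    cubeExpr t A d e g (cubeExpr t A c d f z) = cubeExpr t A c e (g ∘ f) z := by
  have hO := isOpen_exprDomain c d hfc
  have hO' := isOpen_exprDomain c e (hgc.comp hfc)
  have hz'' : z ∈ cubeDomain t A (exprDomain c d f ∩ exprDomain c e (g ∘ f)) :=
    mem_cubeDomain_iff.2 fun S => ⟨mem_cubeDomain_iff.1 hz S, mem_cubeDomain_iff.1 hz' S⟩
  have h1 := cubeMap_congr hK hO (hO.inter hO') hf Set.inter_subset_left (fun _ _ => rfl) hz''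
  have h2 := cubeMap_comp hK (hO.inter hO') (isOpen_exprDomain d e hgc)
    (hf.mono Set.inter_subset_left) hg (fun x hx => ⟨d.map_source hx.1.2, by
      have : d.symm (d (f (c.symm x))) = f (c.symm x) := d.left_inv hx.1.2
      simp only [Function.comp_apply, Set.mem_preimage, this]
      exact hx.2.2⟩) hz''
  have h3 := cubeMap_congr hK hO' (hO.inter hO') hgf Set.inter_subset_right
    (f' := fun x => (e ∘ g ∘ d.symm) ((d ∘ f ∘ c.symm) x)) (fun x hx => by
      have : d.symm (d (f (c.symm x))) = f (c.symm x) := d.left_inv hx.1.2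
      simp only [Function.comp_apply, this]) hz''
  simp only at h2
  rw [h1, h3] at h2
  exact h2.symm

theorem cubeExpr_self [T2Space V] (hK : IsGood K) (c : OpenPartialHomeomorph M V) {z : Cube A V}
    (hz : z ∈ cubeDomain t A c.target) :
    z ∈ cubeDomain t A (exprDomain c c id) ∧ cubeExpr t A c c id z = z := by
  have e : exprDomain c c id = c.target := Set.inter_eq_left.2 fun x hx => c.map_target hx
  refine ⟨e ▸ hz, ?_⟩
  have h1 := cubeMap_congr (f' := c ∘ id ∘ c.symm) hK c.open_target c.open_target
    (isSmoothOn_clm (ContinuousLinearMap.id K V) _) le_rfl (fun x hx => c.right_inv hx) hz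
  rw [cubeExpr, e, h1, cubeMap_clm hK _ c.open_target hz]
  rfl

end Charts

/-! ### The glued space: charts, Hausdorff property, atlas -/

section Vertex

variable {n : ℕ} {K V W : Type u} [CommRing K] [TopologicalSpace K] [IsTopologicalRing K]
  [AddCommGroup V] [Module K V] [TopologicalSpace V] [IsTopologicalAddGroup V] [ContinuousSMul K V]
  [AddCommGroup W] [Module K W] [TopologicalSpace W] [IsTopologicalAddGroup W] [ContinuousSMul K W]
  {t : Fin n → K} {A : Finset (Fin n)}
  {M N : Type*} [TopologicalSpace M] [TopologicalSpace N]
  {𝒜 : Set (OpenPartialHomeomorph M V)} {ℬ : Set (OpenPartialHomeomorph N W)}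

/-- Transition maps are chart expressions of the identity, so the lemmas on `cubeExpr` cover them
too. -/
theorem glued_iff {p q : PreVertex 𝒜 t A} : PreVertex.Glued 𝒜 t A p q ↔
    p.2.1 ∈ cubeDomain t A (exprDomain p.1.1 q.1.1 id) ∧
      cubeExpr t A p.1.1 q.1.1 id p.2.1 = q.2.1 := Iff.rfl

theorem symm_cubeVertex_of_glued [T2Space V] (hK : IsGood K) (hM : IsSmoothAtlas K 𝒜)
    {p q : PreVertex 𝒜 t A} (h : PreVertex.Glued 𝒜 t A p q) (S : Finset (Fin n)) :
    q.1.1.symm (cubeVertex t A S q.2.1) = p.1.1.symm (cubeVertex t A S p.2.1) := by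
  rw [glued_iff] at h
  rw [← h.2]
  exact symm_cubeVertex_cubeExpr hK continuous_id (hM.smooth _ p.1.2 _ q.1.2) h.1 S

/-- If all vertices of a point lie in the domain of a second chart, the point is glued to a point
of the second chart. -/
theorem mem_cubeDomain_exprDomain_of_eq {c : OpenPartialHomeomorph M V}
    {d : OpenPartialHomeomorph M V} {z w : Cube A V} (hz : z ∈ cubeDomain t A c.target)
    (hw : w ∈ cubeDomain t A d.target)
    (h : ∀ S, c.symm (cubeVertex t A S z) = d.symm (cubeVertex t A S w)) :
    z ∈ cubeDomain t A (exprDomain c d id) :=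
  mem_cubeDomain_exprDomain.2 ⟨hz, fun S => by
    rw [id, h]
    exact d.map_target (mem_cubeDomain_iff.1 hw S)⟩

/-- Glued points have the same vertices in `M`, which puts each of them in the domain of the
required transition map. Functoriality then gives its value. -/
theorem glued_equivalence [T2Space V] (hK : IsGood K) (hM : IsSmoothAtlas K 𝒜) :
    Equivalence (PreVertex.Glued 𝒜 t A) where
  refl p := cubeExpr_self hK p.1.1 p.2.2
  symm {p q} h := by
    have h1 := mem_cubeDomain_exprDomain_of_eq q.2.2 p.2.2 (symm_cubeVertex_of_glued hK hM h)
    have h2 := cubeExpr_self hK p.1.1 p.2.2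
    refine glued_iff.2 ⟨h1, ?_⟩
    rw [← (glued_iff.1 h).2]
    exact (cubeExpr_comp hK continuous_id continuous_id (hM.smooth _ p.1.2 _ q.1.2)
      (hM.smooth _ q.1.2 _ p.1.2) (hM.smooth _ p.1.2 _ p.1.2) h.1 h2.1).trans h2.2
  trans {p q r} h h' := by
    have h1 := mem_cubeDomain_exprDomain_of_eq p.2.2 r.2.2 fun S =>
      (symm_cubeVertex_of_glued hK hM h S).symm.trans (symm_cubeVertex_of_glued hK hM h' S).symm
    refine glued_iff.2 ⟨h1, ?_⟩
    rw [← (glued_iff.1 h').2, ← (glued_iff.1 h).2]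
    exact (cubeExpr_comp hK continuous_id continuous_id (hM.smooth _ p.1.2 _ q.1.2)
      (hM.smooth _ q.1.2 _ r.1.2) (hM.smooth _ p.1.2 _ r.1.2) h.1 h1).symm

theorem Vertex.mk_eq_iff [T2Space V] (hK : IsGood K) (hM : IsSmoothAtlas K 𝒜) {c d : 𝒜}
    {z : cubeDomain t A c.1.target} {w : cubeDomain t A d.1.target} :
    (Vertex.mk c z : Vertex 𝒜 t A) = Vertex.mk d w ↔
      z.1 ∈ cubeDomain t A (exprDomain c.1 d.1 id) ∧ cubeExpr t A c.1 d.1 id z.1 = w.1 := by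
  constructor
  · intro h
    exact (glued_equivalence hK hM).eqvGen_iff.1 (Quot.eqvGen_exact h)
  · intro h
    exact Quot.sound h

theorem Vertex.exists_mk (ζ : Vertex 𝒜 t A) : ∃ c z, ζ = Vertex.mk c z := by
  induction ζ using Quot.ind with
  | mk p => exact ⟨p.1, p.2, rfl⟩

/-- The vertices of a point of `M_t^{A;n}`, as points of `M`. -/
noncomputable def Vertex.point [T2Space V] (hK : IsGood K) (hM : IsSmoothAtlas K 𝒜)
    (S : Finset (Fin n)) : Vertex 𝒜 t A → M :=
  Quot.lift (fun p => p.1.1.symm (cubeVertex t A S p.2.1))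
    fun _ _ h => (symm_cubeVertex_of_glued hK hM h S).symm

theorem Vertex.point_mk [T2Space V] (hK : IsGood K) (hM : IsSmoothAtlas K 𝒜)
    (S : Finset (Fin n)) (c : 𝒜) (z : cubeDomain t A c.1.target) :
    Vertex.point hK hM S (Vertex.mk c z) = c.1.symm (cubeVertex t A S z.1) := rfl

theorem Vertex.continuous_point [T2Space V] (hK : IsGood K) (hM : IsSmoothAtlas K 𝒜)
    (S : Finset (Fin n)) :
    Continuous (Vertex.point hK hM S : Vertex 𝒜 t A → M) := by
  refine continuous_quot_lift _ (continuous_sigma fun c => ?_)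
  exact c.1.continuousOn_symm.comp_continuous
    ((continuous_cubeVertex t A S).comp continuous_subtype_val)
    fun z => mem_cubeDomain_iff.1 z.2 S

theorem Vertex.continuous_mk (c : 𝒜) :
    Continuous (Vertex.mk c : cubeDomain t A c.1.target → Vertex 𝒜 t A) :=
  continuous_quot_mk.comp (continuous_sigmaMk (σ := fun c : 𝒜 => cubeDomain t A c.1.target))

theorem continuousOn_cubeExpr [T2Space W] (hK : IsGood K) {c : OpenPartialHomeomorph M V}
    {d : OpenPartialHomeomorph N W} {f : M → N} (hfc : Continuous f)
    (hf : IsSmoothOn K (d ∘ f ∘ c.symm) (exprDomain c d f)) :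
    ContinuousOn (cubeExpr t A c d f) (cubeDomain t A (exprDomain c d f)) :=
  (hf.cubeMap hK t A (isOpen_exprDomain c d hfc)).continuousOn

/-- Seen in another chart `d`, the image of an open set is its preimage under the extended
transition map from `d` to `c`, which is continuous on an open domain. -/
theorem Vertex.isOpenEmbedding_mk [T2Space V] (hK : IsGood K) (hM : IsSmoothAtlas K 𝒜) (c : 𝒜) :
    Topology.IsOpenEmbedding
      (Vertex.mk c : cubeDomain t A c.1.target → Vertex 𝒜 t A) := by
  refine .of_continuous_injective_isOpenMap (Vertex.continuous_mk c) (fun z w h => ?_)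
    fun O hO => ?_
  · have h1 := ((Vertex.mk_eq_iff hK hM).1 h).2
    rw [(cubeExpr_self hK c.1 z.2).2] at h1
    exact Subtype.ext h1
  · refine isQuotientMap_quot_mk.isOpen_preimage.1 (isOpen_sigma_iff.2 fun d => ?_)
    have hO' := (isOpen_cubeDomain c.1.open_target).isOpenMap_subtype_val O hO
    have h1 := (continuousOn_cubeExpr (t := t) (A := A) hK continuous_id
      (hM.smooth d.1 d.2 c.1 c.2)).isOpen_inter_preimage
      (isOpen_cubeDomain (isOpen_exprDomain d.1 c.1 continuous_id)) hO'
    convert h1.preimage (continuous_subtype_val (p := (· ∈ cubeDomain t A d.1.target))) using 1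
    ext w
    constructor
    · rintro ⟨z, hz, h⟩
      have h2 := (Vertex.mk_eq_iff hK hM (c := d) (z := w)).1 h.symm
      exact ⟨h2.1, z, hz, h2.2.symm⟩
    · rintro ⟨h2, z, hz, h⟩
      exact ⟨z, hz, ((Vertex.mk_eq_iff hK hM (c := d) (z := w)).2 ⟨h2, h.symm⟩).symm⟩

open Classical in
/-- The chart of `M_t^{A;n}` induced by a chart of `M`. -/
noncomputable def vertexChart [T2Space V] (hK : IsGood K) (hM : IsSmoothAtlas K 𝒜) (c : 𝒜)
    (ζ₀ : Vertex 𝒜 t A) : OpenPartialHomeomorph (Vertex 𝒜 t A) (Cube A V) where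
  toFun ζ := if h : ∃ z, Vertex.mk c z = ζ then h.choose.1 else 0
  -- The inverse is a total function, and `ζ₀` only serves as its value outside the target.
  invFun v := if h : v ∈ cubeDomain t A c.1.target then Vertex.mk c ⟨v, h⟩ else ζ₀
  source := Set.range (Vertex.mk c)
  target := cubeDomain t A c.1.target
  map_source' ζ h := by
    rw [dif_pos (show ∃ z, Vertex.mk c z = ζ from h)]
    exact Subtype.prop _
  map_target' v h := by
    rw [dif_pos h]
    exact ⟨_, rfl⟩
  left_inv' ζ h := by
    have h' : ∃ z, Vertex.mk c z = ζ := h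
    rw [dif_pos h', dif_pos (Subtype.prop _)]
    exact h'.choose_spec
  right_inv' v h := by
    have h' : ∃ z, Vertex.mk (t := t) (A := A) c z = Vertex.mk c ⟨v, h⟩ := ⟨_, rfl⟩
    rw [dif_pos h, dif_pos h']
    exact congrArg Subtype.val ((Vertex.isOpenEmbedding_mk hK hM c).injective h'.choose_spec)
  open_source := (Vertex.isOpenEmbedding_mk hK hM c).isOpen_range
  open_target := isOpen_cubeDomain c.1.open_target
  continuousOn_toFun := by
    rintro _ ⟨z, rfl⟩
    refine ContinuousAt.continuousWithinAt ?_
    rw [← (Vertex.isOpenEmbedding_mk hK hM c).continuousAt_iff]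
    refine (continuous_subtype_val.congr fun w => ?_).continuousAt
    have h' : ∃ z, Vertex.mk (t := t) (A := A) c z = Vertex.mk c w := ⟨_, rfl⟩
    rw [Function.comp_apply, dif_pos h']
    exact congrArg Subtype.val ((Vertex.isOpenEmbedding_mk hK hM c).injective h'.choose_spec).symm
  continuousOn_invFun := by
    rw [continuousOn_iff_continuous_domRestrict]
    refine (Vertex.continuous_mk c).congr fun z => ?_
    rw [Set.domRestrict_apply, dif_pos z.2]

theorem exists_isVertexChart [T2Space V] (hK : IsGood K) (hM : IsSmoothAtlas K 𝒜) (c : 𝒜)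
    (ζ₀ : Vertex 𝒜 t A) : ∃ C, IsVertexChart t A c C :=
  ⟨vertexChart hK hM c ζ₀, rfl, fun z => dif_pos z.2⟩

/-- If some vertices differ, they are separated in `M` and the separation is pulled back. If all
agree, both points lie in one induced chart, which is Hausdorff. No common charts for arbitrary
finite sets are needed. -/
theorem t2Space_vertex [T2Space M] [T2Space V] (hK : IsGood K) (hM : IsSmoothAtlas K 𝒜) :
    T2Space (Vertex 𝒜 t A) := by
  refine ⟨fun ζ ω hne => ?_⟩
  by_cases h : ∃ S, Vertex.point hK hM S ζ ≠ Vertex.point hK hM S ω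
  · obtain ⟨S, hS⟩ := h
    exact separated_by_continuous (Vertex.continuous_point hK hM S) hS
  · push Not at h
    obtain ⟨c, z, rfl⟩ := ζ.exists_mk
    obtain ⟨d, w, rfl⟩ := ω.exists_mk
    have hz := mem_cubeDomain_exprDomain_of_eq z.2 w.2 h
    have e : (Vertex.mk c z : Vertex 𝒜 t A) = Vertex.mk d
        ⟨_, cubeExpr_mem hK continuous_id (hM.smooth c.1 c.2 d.1 d.2) hz⟩ :=
      (Vertex.mk_eq_iff hK hM).2 ⟨hz, rfl⟩
    rw [e] at hne ⊢
    exact separated_by_isOpenEmbedding (Vertex.isOpenEmbedding_mk hK hM d) fun h => hne (h ▸ rfl)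

/-- The hypothesis `hp` on vertices bounds the domain from above: if `F ζ` lies in the chart induced
by `d`, its vertices, which are the images under `f` of those of `ζ`, lie in `d.source`. -/
theorem IsVertexChart.exprDomain_eq [T2Space V] [T2Space W] (hK : IsGood K)
    (hM : IsSmoothAtlas K 𝒜) (hN : IsSmoothAtlas K ℬ) {f : M → N}
    {F : Vertex 𝒜 t A → Vertex ℬ t A} {c : 𝒜} {d : ℬ}
    {C : OpenPartialHomeomorph (Vertex 𝒜 t A) (Cube A V)}
    {D : OpenPartialHomeomorph (Vertex ℬ t A) (Cube A W)}
    (hC : IsVertexChart t A c C) (hD : IsVertexChart t A d D)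
    (hF : ∀ z : cubeDomain t A c.1.target, z.1 ∈ cubeDomain t A (exprDomain c.1 d.1 f) →
      ∃ w : cubeDomain t A d.1.target, w.1 = cubeExpr t A c.1 d.1 f z.1 ∧
        F (Vertex.mk c z) = Vertex.mk d w)
    (hp : ∀ ζ S, Vertex.point hK hN S (F ζ) = f (Vertex.point hK hM S ζ)) :
    exprDomain C D F = cubeDomain t A (exprDomain c.1 d.1 f) ∧
      Set.EqOn (cubeExpr t A c.1 d.1 f) (D ∘ F ∘ C.symm)
        (cubeDomain t A (exprDomain c.1 d.1 f)) := by
  have key : ∀ z ∈ cubeDomain t A (exprDomain c.1 d.1 f),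
      F (C.symm z) ∈ D.source ∧ D (F (C.symm z)) = cubeExpr t A c.1 d.1 f z := by
    intro z hz
    obtain ⟨w, hw, h⟩ := hF ⟨z, (mem_cubeDomain_exprDomain.1 hz).1⟩ hz
    have hwD : w.1 ∈ D.target := hD.1.symm ▸ w.2
    rw [hC.2 ⟨z, (mem_cubeDomain_exprDomain.1 hz).1⟩, h, ← hD.2, D.right_inv hwD]
    exact ⟨D.map_target hwD, hw⟩
  refine ⟨Set.Subset.antisymm ?_ ?_, fun z hz => (key z hz).2.symm⟩
  · rintro z ⟨hz, hz'⟩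
    rw [hC.1] at hz
    refine mem_cubeDomain_exprDomain.2 ⟨hz, fun S => ?_⟩
    have h1 : D (F (C.symm z)) ∈ cubeDomain t A d.1.target := hD.1 ▸ D.map_source hz'
    have h2 : Vertex.mk d ⟨_, h1⟩ = F (C.symm z) := by
      rw [← hD.2 ⟨_, h1⟩]
      exact D.left_inv hz'
    rw [← Vertex.point_mk hK hM S c ⟨z, hz⟩, ← hp, ← hC.2 ⟨z, hz⟩, ← h2, Vertex.point_mk]
    exact d.1.map_target (mem_cubeDomain_iff.1 h1 S)
  · intro z hz
    exact ⟨hC.1.symm ▸ (mem_cubeDomain_exprDomain.1 hz).1, (key z hz).1⟩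

theorem isSmoothAtlas_vertexAtlas [T2Space V] (hK : IsGood K) (hM : IsSmoothAtlas K 𝒜) :
    IsSmoothAtlas (VertexRing t A) (vertexAtlas 𝒜 t A) where
  cover ζ := by
    obtain ⟨c, z, rfl⟩ := ζ.exists_mk
    obtain ⟨C, hC⟩ := exists_isVertexChart hK hM c (Vertex.mk c z)
    refine ⟨C, ⟨c, hC⟩, ?_⟩
    rw [← hC.2]
    exact C.map_target (hC.1.symm ▸ z.2)
  smooth := by
    rintro C ⟨c, hC⟩ D ⟨d, hD⟩
    have hs := hM.smooth c.1 c.2 d.1 d.2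
    obtain ⟨h1, h2⟩ := IsVertexChart.exprDomain_eq hK hM hM (f := id) (F := id) hC hD
      (fun z hz => ⟨⟨_, cubeExpr_mem hK continuous_id hs hz⟩, rfl,
        (Vertex.mk_eq_iff hK hM).2 ⟨hz, rfl⟩⟩) fun ζ S => rfl
    exact (hs.cubeMap_vertexRing hK t A (isOpen_exprDomain c.1 d.1 continuous_id)).congr h1.le
      (h2.mono h1.le)

end Vertex


/-! ### Locality of `C^m` over a field with continuous inversion -/

section Local

variable {K V W : Type u} [CommRing K] [TopologicalSpace K] [IsTopologicalRing K]
  [AddCommGroup V] [Module K V] [TopologicalSpace V] [IsTopologicalAddGroup V] [ContinuousSMul K V]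
  [AddCommGroup W] [Module K W] [TopologicalSpace W] [IsTopologicalAddGroup W] [ContinuousSMul K W]

theorem IsCn.line {m : ℕ} (D : Set (V × V × K)) :
    IsCn K m (fun p : V × V × K => p.1 + p.2.2 • p.2.1) D :=
  (IsCn.clm (ContinuousLinearMap.fst K V (V × K)) D).add
    ((IsCn.clm ((ContinuousLinearMap.snd K V K).comp (ContinuousLinearMap.snd K V (V × K))) D).smul
      (IsCn.clm ((ContinuousLinearMap.fst K V K).comp (ContinuousLinearMap.snd K V (V × K))) D))

/-- The quotient is `-v / (x (x + s v))`, again a product of inverses and a linear map. -/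
theorem isCn_inverse (hinv : ContinuousOn Ring.inverse {a : K | IsUnit a}) (m : ℕ) :
    IsCn K m (Ring.inverse : K → K) {a : K | IsUnit a} := by
  induction m with
  | zero => exact hinv
  | succ m ih =>
    refine ⟨fun p => (-1 : K) • (Ring.inverse p.1 • (Ring.inverse (p.1 + p.2.2 • p.2.1) • p.2.1)),
      ?_, ?_⟩
    · rintro ⟨x, v, s⟩ ⟨h1, h2⟩
      have e1 : Ring.inverse x * x = 1 := Ring.inverse_mul_cancel x h1
      have e2 : Ring.inverse (x + s • v) * (x + s • v) = 1 := Ring.inverse_mul_cancel _ h2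
      simp only [smul_eq_mul] at e2 ⊢
      linear_combination -Ring.inverse (x + s * v) * e1 + Ring.inverse x * e2
    · exact (IsCn.const _ _).smul ((ih.comp
        (.clm (ContinuousLinearMap.fst K K (K × K)) _) fun p hp => hp.1).smul
        ((ih.comp (.line _) fun p hp => hp.2).smul
          (.clm ((ContinuousLinearMap.fst K K K).comp (ContinuousLinearMap.snd K K (K × K))) _)))

open Classical in
/-- Over a field with continuous inversion, the class `C^m` is local. -/
theorem isCn_of_local [T2Space W] (hK : IsGood K) (hF : IsField K)
    (hu : IsOpen {a : K | IsUnit a}) (hinv : ContinuousOn Ring.inverse {a : K | IsUnit a}) {m : ℕ}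
    {f : V → W} {U : Set V} (hU : IsOpen U)
    (h : ∀ x ∈ U, ∃ O, IsOpen O ∧ x ∈ O ∧ IsCn K m f O) : IsCn K m f U := by
  induction m generalizing V with
  | zero =>
    intro x hx
    obtain ⟨O, hO, hxO, h⟩ := h x hx
    exact (h.continuousAt (hO.mem_nhds hxO)).continuousWithinAt
  | succ m ih =>
    have h' : ∀ x : U, ∃ (O : Set V) (g : V × V × K → W), IsOpen O ∧ x.1 ∈ O ∧
        IsSlope K f O g ∧ IsCn K m g (extDomain K O) := fun x => by
      obtain ⟨O, hO, hxO, g, hg, hg'⟩ := h x x.2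
      exact ⟨O, g, hO, hxO, hg, hg'⟩
    choose O g hO hxO hg hgm using h'
    have h0 : ∀ {a : K}, ¬ IsUnit a → a = 0 := fun {a} ha => by
      by_contra hne
      obtain ⟨b, hb⟩ := hF.mul_inv_cancel hne
      exact ha (IsUnit.of_mul_eq_one b hb)
    have hfm : ∀ x, IsCn K m f (O x) := fun x => IsCn.of_succ ⟨g x, hg x, hgm x⟩
    -- For invertible `s` the value is forced. For `s = 0` the local quotient chosen at the base
    -- point is used.
    refine ⟨fun p => if IsUnit p.2.2 then Ring.inverse p.2.2 • (f (p.1 + p.2.2 • p.2.1) - f p.1)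
      else if hp : p.1 ∈ U then g ⟨p.1, hp⟩ p else 0, ?_, ih (isOpen_extDomain hU) ?_⟩
    · intro p hp
      by_cases hu : IsUnit p.2.2
      · simp only [if_pos hu, smul_smul, Ring.mul_inverse_cancel _ hu, one_smul]
      · simp [h0 hu]
    · intro p hp
      have hc : Continuous fun p : V × V × K => p.1 + p.2.2 • p.2.1 := by fun_prop
      by_cases hpu : IsUnit p.2.2
      -- Invertible `s`: the endpoints `x` and `x + s v` may need different neighbourhoods. Since
      -- units are open, the explicit formula holds nearby.
      · refine ⟨(Prod.fst ⁻¹' O ⟨_, hp.1⟩ ∩ (fun p : V × V × K => p.1 + p.2.2 • p.2.1) ⁻¹'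
          O ⟨_, hp.2⟩) ∩ (fun p : V × V × K => p.2.2) ⁻¹' {a | IsUnit a},
          (((hO _).preimage continuous_fst).inter ((hO _).preimage hc)).inter
            (hu.preimage (by fun_prop)), ⟨⟨hxO ⟨_, hp.1⟩, hxO ⟨_, hp.2⟩⟩, hpu⟩, ?_⟩
        refine IsCn.congr (f := fun p : V × V × K => Ring.inverse p.2.2 •
          (f (p.1 + p.2.2 • p.2.1) + (-1 : K) • f p.1)) ?_ le_rfl fun q hq => ?_
        · refine IsCn.smul ((isCn_inverse hinv m).comp (.clm ((ContinuousLinearMap.snd K V K).comp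
            (ContinuousLinearMap.snd K V (V × K))) _) fun q hq => hq.2) (.add ?_
              ((IsCn.const _ _).smul ?_))
          · exact (hfm _).comp (.line _) fun q hq => hq.1.2
          · exact (hfm _).comp (.clm (ContinuousLinearMap.fst K V (V × K)) _) fun q hq => hq.1.1
        · have hq' : IsUnit q.2.2 := hq.2
          simp only [if_pos hq', neg_smul, one_smul, sub_eq_add_neg]
      -- Scalar `0`: both endpoints lie in one neighbourhood, and there the glued quotient equals
      -- the single local one. At other points with scalar `0`, uniqueness on the intersection of
      -- two neighbourhoods identifies the local quotients.
      · refine ⟨extDomain K (O ⟨_, hp.1⟩ ∩ U), isOpen_extDomain ((hO _).inter hU), ?_, ?_⟩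
        · have h3 : p.1 ∈ O ⟨_, hp.1⟩ ∩ U := ⟨hxO ⟨_, hp.1⟩, hp.1⟩
          exact ⟨h3, by simpa [h0 hpu] using h3⟩
        · refine (hgm ⟨_, hp.1⟩).congr (extDomain_mono Set.inter_subset_left) fun q hq => ?_
          by_cases hqu : IsUnit q.2.2
          · simp only [if_pos hqu]
            rw [hg ⟨_, hp.1⟩ q (extDomain_mono Set.inter_subset_left hq), smul_smul,
              Ring.inverse_mul_cancel _ hqu, one_smul]
          · have hq1 : q.1 ∈ U := hq.1.2
            simp only [if_neg hqu, dif_pos hq1]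
            have hle : ∀ x y : U, IsSlope K f (O x ∩ O y) (g x) ∧
                ContinuousOn (g x) (extDomain K (O x ∩ O y)) := fun x y =>
              ⟨(hg x).congr Set.inter_subset_left fun _ _ => rfl,
                (hgm x).continuousOn.mono (extDomain_mono Set.inter_subset_left)⟩
            have h1 := hle ⟨_, hp.1⟩ ⟨_, hq1⟩
            have h2 := hle ⟨_, hq1⟩ ⟨_, hp.1⟩
            rw [Set.inter_comm] at h2
            refine h1.1.eqOn hK ((hO _).inter (hO _)) h1.2 h2.1 h2.2 ?_
            have e0 := h0 hqu
            have h3 : q.1 ∈ O ⟨_, hp.1⟩ ∩ O ⟨_, hq1⟩ := ⟨hq.1.1, hxO ⟨_, hq1⟩⟩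
            exact ⟨h3, by simpa [e0] using h3⟩

end Local

/-! ### Consequences of `K` being a field -/

section CommonCharts

variable {K W : Type u} [CommRing K] [TopologicalSpace K] [IsTopologicalRing K]
  [AddCommGroup W] [Module K W] [TopologicalSpace W] [IsTopologicalAddGroup W] [ContinuousSMul K W]

theorem smul_left_injective_of_isField (hF : IsField K) {w : W} (hw : w ≠ 0) :
    Function.Injective fun a : K => a • w := by
  intro a b hab
  by_contra hne
  obtain ⟨c, hc⟩ := hF.mul_inv_cancel (sub_ne_zero.2 hne)
  have h : (a - b) • w = 0 := by
    rw [sub_smul]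
    exact sub_eq_zero.2 hab
  apply hw
  rw [← one_smul K w, ← hc, mul_comm, mul_smul, h, smul_zero]

theorem isUnit_iff_of_isField (hF : IsField K) {a : K} : IsUnit a ↔ a ≠ 0 := by
  constructor
  · rintro h rfl
    obtain ⟨x, y, hxy⟩ := hF.exists_pair_ne
    have := subsingleton_of_zero_eq_one (isUnit_zero_iff.1 h)
    exact hxy (Subsingleton.elim _ _)
  · intro h
    obtain ⟨b, hb⟩ := hF.mul_inv_cancel h
    exact IsUnit.of_mul_eq_one b hb

theorem t2Space_of_isField [T2Space W] [Nontrivial W] (hF : IsField K) : T2Space K := by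
  obtain ⟨w, hw⟩ := exists_ne (0 : W)
  exact .of_injective_continuous (smul_left_injective_of_isField hF hw) (by fun_prop)

/-- A finite Hausdorff `K` would be discrete, so density would make `0` a unit. Infinitude of `W`
leaves room to translate charts away from finitely many points. -/
theorem infinite_of_isField [T2Space W] [Nontrivial W] (hK : IsGood K) (hF : IsField K) :
    Infinite W := by
  have := t2Space_of_isField (W := W) hF
  obtain ⟨w, hw⟩ := exists_ne (0 : W)
  have : Infinite K := by
    by_contra h
    rw [not_infinite_iff_finite] at h
    have h1 := dense_discrete.1 hK
    have h2 : (0 : K) ∈ {a : K | IsUnit a} := h1 ▸ Set.mem_univ _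
    exact (isUnit_iff_of_isField hF).1 h2 rfl
  exact .of_injective _ (smul_left_injective_of_isField hF hw)

theorem isOpen_isUnit_of_isField [T2Space W] [Nontrivial W] (hF : IsField K) :
    IsOpen {a : K | IsUnit a} := by
  have := t2Space_of_isField (W := W) hF
  simp only [isUnit_iff_of_isField hF]
  exact isOpen_ne

theorem isSmoothOn_of_local {V : Type u} [AddCommGroup V] [Module K V] [TopologicalSpace V]
    [IsTopologicalAddGroup V] [ContinuousSMul K V] [T2Space W] [Nontrivial W] (hK : IsGood K)
    (hF : IsField K) (hinv : ContinuousOn Ring.inverse {a : K | IsUnit a}) {f : V → W} {U : Set V}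
    (hU : IsOpen U) (h : ∀ x ∈ U, ∃ O, IsOpen O ∧ x ∈ O ∧ IsSmoothOn K f O) :
    IsSmoothOn K f U := fun m =>
  isCn_of_local hK hF (isOpen_isUnit_of_isField (W := W) hF) hinv hU fun x hx => by
    obtain ⟨O, hO, hxO, h⟩ := h x hx
    exact ⟨O, hO, hxO, h m⟩

end CommonCharts


/-! ### Common charts in a maximal atlas -/

section Compatible

variable {K W : Type u} [CommRing K] [TopologicalSpace K] [IsTopologicalRing K]
  [AddCommGroup W] [Module K W] [TopologicalSpace W] [IsTopologicalAddGroup W] [ContinuousSMul K W]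
  {N : Type*} [TopologicalSpace N] {ℬ : Set (OpenPartialHomeomorph N W)}

/-- The chart `c` has smooth coordinate changes with all charts of `ℬ`. -/
def IsCompatible (K : Type u) {W : Type u} {N : Type*} [CommRing K] [TopologicalSpace K]
    [AddCommGroup W] [Module K W] [TopologicalSpace W] [TopologicalSpace N]
    (ℬ : Set (OpenPartialHomeomorph N W)) (c : OpenPartialHomeomorph N W) : Prop :=
  ∀ d ∈ ℬ, IsSmoothOn K (d ∘ c.symm) (c.target ∩ c.symm ⁻¹' d.source) ∧
    IsSmoothOn K (c ∘ d.symm) (d.target ∩ d.symm ⁻¹' c.source)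

theorem IsSmoothAtlas.isCompatible (hN : IsSmoothAtlas K ℬ) {c : OpenPartialHomeomorph N W}
    (hc : c ∈ ℬ) : IsCompatible K ℬ c := fun d hd => ⟨hN.smooth c hc d hd, hN.smooth d hd c hc⟩

theorem IsCompatible.restrOpen {c : OpenPartialHomeomorph N W} (h : IsCompatible K ℬ c) {s : Set N}
    (hs : IsOpen s) : IsCompatible K ℬ (c.restrOpen s hs) := fun d hd =>
  ⟨(h d hd).1.mono (Set.inter_subset_inter_left _ Set.inter_subset_left),
    (h d hd).2.mono (Set.inter_subset_inter_right _ (Set.preimage_mono Set.inter_subset_left))⟩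

theorem IsCompatible.translate {c : OpenPartialHomeomorph N W} (h : IsCompatible K ℬ c) (y : W) :
    IsCompatible K ℬ (c.transHomeomorph (Homeomorph.addRight y)) := fun d hd => by
  constructor
  · exact (h d hd).1.comp (f := fun x => x + -y)
      ((isSmoothOn_clm (ContinuousLinearMap.id K W) _).add (isSmoothOn_const (-y) _))
      fun x hx => hx
  · exact (h d hd).2.add (isSmoothOn_const y _)

theorem exists_disjointUnion (c d : OpenPartialHomeomorph N W) (hs : Disjoint c.source d.source)
    (ht : Disjoint c.target d.target) : ∃ e : OpenPartialHomeomorph N W,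
      e.source = c.source ∪ d.source ∧ e.target = c.target ∪ d.target ∧
      Set.EqOn c e c.source ∧ Set.EqOn d e d.source ∧
      Set.EqOn c.symm e.symm c.target ∧ Set.EqOn d.symm e.symm d.target := by
  classical
  refine ⟨c.disjointUnion d hs ht, rfl, rfl, fun x hx => ?_, fun x hx => ?_, fun x hx => ?_,
    fun x hx => ?_⟩
  · exact (if_pos hx).symm
  · exact (if_neg (hs.notMem_of_mem_right hx)).symm
  · exact (if_pos hx).symm
  · exact (if_neg (ht.notMem_of_mem_right hx)).symm

/-- Near each point the coordinate changes of the union are those of `c` or of `d`, and smoothness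
is local over such a field. -/
theorem IsCompatible.disjointUnion [T2Space W] [Nontrivial W] (hK : IsGood K) (hF : IsField K)
    (hinv : ContinuousOn Ring.inverse {a : K | IsUnit a}) {c d : OpenPartialHomeomorph N W}
    (hc : IsCompatible K ℬ c) (hd : IsCompatible K ℬ d) (hs : Disjoint c.source d.source)
    (ht : Disjoint c.target d.target) : ∃ e : OpenPartialHomeomorph N W,
      e.source = c.source ∪ d.source ∧ IsCompatible K ℬ e := by
  obtain ⟨e, h1, h2, h3, h4, h5, h6⟩ := exists_disjointUnion c d hs ht
  refine ⟨e, h1, fun a ha => ⟨?_, ?_⟩⟩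
  · refine isSmoothOn_of_local hK hF hinv (e.isOpen_inter_preimage_symm a.open_source) ?_
    rintro x ⟨hx, hxa⟩
    rw [h2] at hx
    rcases hx with hx | hx
    · refine ⟨_, c.isOpen_inter_preimage_symm a.open_source, ⟨hx, ?_⟩,
        (hc a ha).1.congr le_rfl fun z hz => congrArg a (h5 hz.1)⟩
      rw [Set.mem_preimage, h5 hx]
      exact hxa
    · refine ⟨_, d.isOpen_inter_preimage_symm a.open_source, ⟨hx, ?_⟩,
        (hd a ha).1.congr le_rfl fun z hz => congrArg a (h6 hz.1)⟩
      rw [Set.mem_preimage, h6 hx]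
      exact hxa
  · refine isSmoothOn_of_local hK hF hinv (a.isOpen_inter_preimage_symm e.open_source) ?_
    rintro x ⟨hx, hxa⟩
    rw [Set.mem_preimage, h1] at hxa
    rcases hxa with hxa | hxa
    · exact ⟨_, a.isOpen_inter_preimage_symm c.open_source, ⟨hx, hxa⟩,
        (hc a ha).2.congr le_rfl fun z hz => h3 hz.2⟩
    · exact ⟨_, a.isOpen_inter_preimage_symm d.open_source, ⟨hx, hxa⟩,
        (hd a ha).2.congr le_rfl fun z hz => h4 hz.2⟩

/-- Over a field with continuous inversion, finitely many points lie in one chart of a maximal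
atlas: charts around the points are shrunk and translated so as to be disjoint. -/
theorem IsMaximalAtlas.hasCommonCharts [T2Space N] [Nontrivial W] (hK : IsGood K)
    (hF : IsField K) (hinv : ContinuousOn Ring.inverse {a : K | IsUnit a})
    (hN : IsSmoothAtlas K ℬ) (hmax : IsMaximalAtlas K ℬ) : HasCommonCharts ℬ := by
  classical
  intro s hs
  induction hs using Finset.Nonempty.cons_induction with
  | singleton q =>
    obtain ⟨c, hc, hq⟩ := hN.cover q
    exact ⟨c, hc, by simpa using hq⟩
  | cons q s hqs _ ih =>
    obtain ⟨c, hc, hsc⟩ := ih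
    obtain ⟨d, hd, hqd⟩ := hN.cover q
    have : T2Space W := t2Space_of_chart d ⟨_, d.map_source hqd⟩
    have := infinite_of_isField (W := W) hK hF
    -- The translation `y` makes the new coordinate `d q + y` of `q` different from the coordinates
    -- `c p` of the other points. Shrinking can then separate the charts both in `N` and in `W`.
    obtain ⟨y, hy⟩ := Infinite.exists_notMem_finset (s.image fun p => c p - d q)
    have hy' : d q + y ∉ s.image c := by
      intro h
      obtain ⟨p, hp, e⟩ := Finset.mem_image.1 h
      exact hy (Finset.mem_image.2 ⟨p, hp, by rw [e, add_sub_cancel_left]⟩)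
    obtain ⟨Q, P, hQ, hP, hqQ, hsP, hPQ⟩ := SeparatedNhds.of_singleton_finset hqs
    obtain ⟨Q', P', hQ', hP', hqQ', hsP', hPQ'⟩ := SeparatedNhds.of_singleton_finset hy'
    let d' := d.transHomeomorph (Homeomorph.addRight y)
    have ho : IsOpen (c.source ∩ c ⁻¹' P' ∩ P) := (c.isOpen_inter_preimage hP').inter hP
    have ho' : IsOpen (d'.source ∩ d' ⁻¹' Q' ∩ Q) := (d'.isOpen_inter_preimage hQ').inter hQ
    obtain ⟨e, he, he'⟩ := IsCompatible.disjointUnion hK hF hinv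
      ((hN.isCompatible hc).restrOpen ho) (((hN.isCompatible hd).translate y).restrOpen ho')
      (hPQ.symm.mono (fun x hx => hx.2.2) fun x hx => hx.2.2)
      (hPQ'.symm.mono (fun x hx => by
        have h : c (c.symm x) ∈ P' := hx.2.1.2
        rwa [c.right_inv hx.1] at h) fun x hx => by
        have h : d' (d'.symm x) ∈ Q' := hx.2.1.2
        rwa [d'.right_inv hx.1] at h)
    refine ⟨e, hmax e he', ?_⟩
    rw [he, Finset.coe_cons, Set.insert_subset_iff]
    refine ⟨Or.inr ⟨hqd, ⟨hqd, ?_⟩, hqQ rfl⟩, fun p hp => Or.inl ⟨hsc hp, ⟨hsc hp, ?_⟩, hsP hp⟩⟩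
    · exact hqQ' rfl
    · exact hsP' (Finset.mem_coe.2 (Finset.mem_image_of_mem c hp))

end Compatible

/-! ### The extension of a smooth map between manifolds -/

section VertexMap

variable {n : ℕ} {K V W : Type u} [CommRing K] [TopologicalSpace K] [IsTopologicalRing K]
  [AddCommGroup V] [Module K V] [TopologicalSpace V] [IsTopologicalAddGroup V] [ContinuousSMul K V]
  [AddCommGroup W] [Module K W] [TopologicalSpace W] [IsTopologicalAddGroup W] [ContinuousSMul K W]
  {t : Fin n → K} {A : Finset (Fin n)}
  {M N : Type*} [TopologicalSpace M] [TopologicalSpace N]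
  {𝒜 : Set (OpenPartialHomeomorph M V)} {ℬ : Set (OpenPartialHomeomorph N W)}

/-- There are only finitely many vertices, one for each `S`, so their images under `f` form a finite
set. -/
theorem HasCommonCharts.exists_chart (h : HasCommonCharts ℬ) (f : M → N)
    (c : OpenPartialHomeomorph M V) {z : Cube A V} (hz : z ∈ cubeDomain t A c.target) :
    ∃ d : ℬ, z ∈ cubeDomain t A (exprDomain c d.1 f) := by
  classical
  obtain ⟨d, hd, hs⟩ := h (Finset.univ.image fun S => f (c.symm (cubeVertex t A S z)))
    (Finset.univ_nonempty.image _)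
  exact ⟨⟨d, hd⟩, mem_cubeDomain_exprDomain.2 ⟨hz, fun S =>
    hs (Finset.mem_coe.2 (Finset.mem_image_of_mem _ (Finset.mem_univ S)))⟩⟩

/-- Both values are compared with the mixed expression of `f` from `c` to `d'`, which factors
through `d` as `id ∘ f` and through `c'` as `f ∘ id`. -/
theorem cubeExpr_glued [T2Space V] [T2Space W] (hK : IsGood K) (hM : IsSmoothAtlas K 𝒜)
    (hN : IsSmoothAtlas K ℬ) {f : M → N} (hf : IsSmoothMap K 𝒜 ℬ f) {c c' : 𝒜} {d d' : ℬ}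
    {z : cubeDomain t A c.1.target} {z' : cubeDomain t A c'.1.target}
    (h : (Vertex.mk c z : Vertex 𝒜 t A) = Vertex.mk c' z')
    (hz : z.1 ∈ cubeDomain t A (exprDomain c.1 d.1 f))
    (hz' : z'.1 ∈ cubeDomain t A (exprDomain c'.1 d'.1 f)) :
    (Vertex.mk d ⟨_, cubeExpr_mem hK hf.continuous (hf.smooth c.1 c.2 d.1 d.2) hz⟩ :
      Vertex ℬ t A) =
      Vertex.mk d' ⟨_, cubeExpr_mem hK hf.continuous (hf.smooth c'.1 c'.2 d'.1 d'.2) hz'⟩ := by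
  obtain ⟨h1, h2⟩ := (Vertex.mk_eq_iff hK hM).1 h
  have hp : ∀ S, c'.1.symm (cubeVertex t A S z'.1) = c.1.symm (cubeVertex t A S z.1) := fun S =>
    (congrArg (Vertex.point hK hM S) h).symm
  have hz'' : z.1 ∈ cubeDomain t A (exprDomain c.1 d'.1 f) :=
    mem_cubeDomain_exprDomain.2 ⟨z.2, fun S => by
      rw [← hp]
      exact (mem_cubeDomain_exprDomain.1 hz').2 S⟩
  refine (Vertex.mk_eq_iff hK hN).2 ⟨mem_cubeDomain_exprDomain.2
    ⟨cubeExpr_mem hK hf.continuous (hf.smooth c.1 c.2 d.1 d.2) hz, fun S => ?_⟩, ?_⟩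
  · simp only [symm_cubeVertex_cubeExpr hK hf.continuous (hf.smooth c.1 c.2 d.1 d.2) hz]
    exact (mem_cubeDomain_exprDomain.1 hz'').2 S
  · have e1 := cubeExpr_comp (g := id) hK hf.continuous continuous_id (hf.smooth c.1 c.2 d.1 d.2)
      (hN.smooth d.1 d.2 d'.1 d'.2) (hf.smooth c.1 c.2 d'.1 d'.2) hz hz''
    have e2 := cubeExpr_comp (f := id) hK continuous_id hf.continuous
      (hM.smooth c.1 c.2 c'.1 c'.2) (hf.smooth c'.1 c'.2 d'.1 d'.2)
      (hf.smooth c.1 c.2 d'.1 d'.2) h1 hz''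
    rw [h2] at e2
    exact e1.trans e2.symm

/-- Every point admits a suitable pair of charts, each such pair prescribes the value, and all pairs
prescribe the same one. Continuity and smoothness are then read off in charts. -/
theorem exists_vertexMap [T2Space V] [T2Space W] (hK : IsGood K) (hM : IsSmoothAtlas K 𝒜)
    (hN : IsSmoothAtlas K ℬ) (hB : HasCommonCharts ℬ) {f : M → N} (hf : IsSmoothMap K 𝒜 ℬ f) :
    ∃ F : Vertex 𝒜 t A → Vertex ℬ t A, (∀ G, IsVertexMap 𝒜 ℬ t A f G ↔ G = F) ∧
      IsSmoothMap (VertexRing t A) (vertexAtlas 𝒜 t A) (vertexAtlas ℬ t A) F := by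
  have key : ∀ ζ : Vertex 𝒜 t A, ∃ ω : Vertex ℬ t A, ∀ (c : 𝒜) (d : ℬ)
      (z : cubeDomain t A c.1.target) (hz : z.1 ∈ cubeDomain t A (exprDomain c.1 d.1 f)),
      Vertex.mk c z = ζ →
        ω = Vertex.mk d ⟨_, cubeExpr_mem hK hf.continuous (hf.smooth c.1 c.2 d.1 d.2) hz⟩ := by
    intro ζ
    obtain ⟨c, z, rfl⟩ := ζ.exists_mk
    obtain ⟨d, hd⟩ := hB.exists_chart f c.1 z.2
    exact ⟨_, fun c' d' z' hz' h => cubeExpr_glued hK hM hN hf h.symm hd hz'⟩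
  choose F hF using key
  have hFV : IsVertexMap 𝒜 ℬ t A f F := fun c d z hz => ⟨_, rfl, hF _ c d z hz rfl⟩
  have hp : ∀ ζ S, Vertex.point hK hN S (F ζ) = f (Vertex.point hK hM S ζ) := by
    intro ζ S
    obtain ⟨c, z, rfl⟩ := ζ.exists_mk
    obtain ⟨d, hd⟩ := hB.exists_chart f c.1 z.2
    rw [hF _ c d z hd rfl]
    exact symm_cubeVertex_cubeExpr hK hf.continuous (hf.smooth c.1 c.2 d.1 d.2) hd S
  have hexpr : ∀ {c : 𝒜} {d : ℬ} {C D}, IsVertexChart t A c C → IsVertexChart t A d D →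
      exprDomain C D F = cubeDomain t A (exprDomain c.1 d.1 f) ∧
      Set.EqOn (cubeExpr t A c.1 d.1 f) (D ∘ F ∘ C.symm)
        (cubeDomain t A (exprDomain c.1 d.1 f)) := fun {c d C D} hC hD =>
    IsVertexChart.exprDomain_eq hK hM hN hC hD (hFV c d) hp
  refine ⟨F, fun G => ⟨fun hG => funext fun ζ => ?_, fun h => h ▸ hFV⟩, ?_, ?_⟩
  · obtain ⟨c, z, rfl⟩ := ζ.exists_mk
    obtain ⟨d, hd⟩ := hB.exists_chart f c.1 z.2
    obtain ⟨w, hw, h⟩ := hG c d z hd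
    rw [h, hF _ c d z hd rfl]
    exact congrArg _ (Subtype.ext hw)
  · refine continuous_iff_continuousAt.2 fun ζ => ?_
    obtain ⟨c, z, rfl⟩ := ζ.exists_mk
    obtain ⟨d, hd⟩ := hB.exists_chart f c.1 z.2
    have hO : IsOpen (cubeDomain t A (exprDomain c.1 d.1 f)) :=
      isOpen_cubeDomain (isOpen_exprDomain c.1 d.1 hf.continuous)
    rw [← (Vertex.isOpenEmbedding_mk hK hM c).continuousAt_iff]
    have hv : Continuous (Subtype.val : cubeDomain t A c.1.target → Cube A V) :=
      continuous_subtype_val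
    refine ContinuousOn.continuousAt (s := Subtype.val ⁻¹' cubeDomain t A (exprDomain c.1 d.1 f))
      ?_ ((hO.preimage hv).mem_nhds hd)
    rw [continuousOn_iff_continuous_domRestrict]
    refine (Vertex.continuous_mk d).comp (f := fun y : (Subtype.val ⁻¹' cubeDomain t A
      (exprDomain c.1 d.1 f) : Set (cubeDomain t A c.1.target)) => (⟨_, cubeExpr_mem hK
        hf.continuous (hf.smooth c.1 c.2 d.1 d.2) y.2⟩ : cubeDomain t A d.1.target))
      (Continuous.subtype_mk ?_ _) |>.congr fun y => (hF _ c d y.1 y.2 rfl).symm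
    exact (continuousOn_cubeExpr hK hf.continuous (hf.smooth c.1 c.2 d.1 d.2)).comp_continuous
      (hv.comp continuous_subtype_val) fun y => y.2
  · rintro C ⟨c, hC⟩ D ⟨d, hD⟩
    obtain ⟨h1, h2⟩ := hexpr hC hD
    exact ((hf.smooth c.1 c.2 d.1 d.2).cubeMap_vertexRing hK t A
      (isOpen_exprDomain c.1 d.1 hf.continuous)).congr h1.le (h2.mono h1.le)

theorem IsSmoothAtlas.t2Space [T2Space M] [Nonempty M] (hM : IsSmoothAtlas K 𝒜) : T2Space V := by
  obtain ⟨c, _, h⟩ := hM.cover (Classical.arbitrary M)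
  exact t2Space_of_chart c ⟨_, c.map_source h⟩

theorem IsSmoothAtlas.nonempty_vertex [Nonempty M] (hM : IsSmoothAtlas K 𝒜) :
    Nonempty (Vertex 𝒜 t A) := by
  obtain ⟨c, hc, h⟩ := hM.cover (Classical.arbitrary M)
  obtain ⟨z, hz⟩ := cubeDomain_nonempty (t := t) (A := A) (U := c.target) ⟨_, c.map_source h⟩
  exact ⟨Vertex.mk ⟨c, hc⟩ ⟨z, hz⟩⟩

theorem isEmpty_vertex [IsEmpty M] : IsEmpty (Vertex 𝒜 t A) :=
  ⟨fun ζ => by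
    obtain ⟨c, _, _⟩ := ζ.exists_mk
    exact isEmptyElim (c.1.symm 0)⟩

end VertexMap

end LieCalculus

theorem theorem5p12 {K : Type u} [CommRing K] [TopologicalSpace K] [IsTopologicalRing K]
    (hK : LieCalculus.IsGood K)
    {V W : Type u} [AddCommGroup V] [Module K V] [TopologicalSpace V] [IsTopologicalAddGroup V]
    [ContinuousSMul K V] [AddCommGroup W] [Module K W] [TopologicalSpace W]
    [IsTopologicalAddGroup W] [ContinuousSMul K W]
    {M N : Type*} [TopologicalSpace M] [T2Space M] [TopologicalSpace N] [T2Space N]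
    (𝒜 : Set (OpenPartialHomeomorph M V)) (hM : LieCalculus.IsSmoothAtlas K 𝒜)
    (ℬ : Set (OpenPartialHomeomorph N W)) (hN : LieCalculus.IsSmoothAtlas K ℬ)
    (n : ℕ) (t : Fin n → K) (A : Finset (Fin n)) :
    ((∀ c : 𝒜, ∃ C, LieCalculus.IsVertexChart t A c C) ∧
      T2Space (LieCalculus.Vertex 𝒜 t A) ∧
      LieCalculus.IsSmoothAtlas (LieCalculus.VertexRing t A) (LieCalculus.vertexAtlas 𝒜 t A)) ∧
    ((LieCalculus.HasCommonCharts ℬ ∨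
        (IsField K ∧ ContinuousOn Ring.inverse {a : K | IsUnit a} ∧ Nontrivial W ∧
          LieCalculus.IsMaximalAtlas K ℬ)) →
      ∀ f : M → N, LieCalculus.IsSmoothMap K 𝒜 ℬ f →
        ∃ F : LieCalculus.Vertex 𝒜 t A → LieCalculus.Vertex ℬ t A,
          (∀ G, LieCalculus.IsVertexMap 𝒜 ℬ t A f G ↔ G = F) ∧
          LieCalculus.IsSmoothMap (LieCalculus.VertexRing t A)
            (LieCalculus.vertexAtlas 𝒜 t A) (LieCalculus.vertexAtlas ℬ t A) F) := by
  cases isEmpty_or_nonempty M with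
  | inl _ =>
    have := LieCalculus.isEmpty_vertex (𝒜 := 𝒜) (t := t) (A := A)
    -- The empty case is separate because `V` need not be Hausdorff there. The inverse of a chart is
    -- a total map `V → M`, so an empty `M` has no charts.
    have h𝒜 : IsEmpty 𝒜 := ⟨fun c => isEmptyElim (c.1.symm 0)⟩
    refine ⟨⟨isEmptyElim, ⟨isEmptyElim⟩, isEmptyElim, ?_⟩, fun _ f hf =>
      ⟨isEmptyElim, fun G => ?_, ?_, ?_⟩⟩
    · rintro C ⟨c, _⟩
      exact isEmptyElim c
    · exact ⟨fun _ => Subsingleton.elim _ _, fun _ => isEmptyElim⟩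
    · exact ⟨fun s _ => by simp [Set.eq_empty_of_isEmpty]⟩
    · rintro C ⟨c, _⟩
      exact isEmptyElim c
  | inr _ =>
    have : T2Space V := hM.t2Space
    obtain ⟨ζ₀⟩ := hM.nonempty_vertex (t := t) (A := A)
    refine ⟨⟨fun c => LieCalculus.exists_isVertexChart hK hM c ζ₀,
      LieCalculus.t2Space_vertex hK hM, LieCalculus.isSmoothAtlas_vertexAtlas hK hM⟩,
      fun h f hf => ?_⟩
    -- A point of `N` is needed to conclude from a chart around it that `W` is Hausdorff.
    have : Nonempty N := ⟨f (Classical.arbitrary M)⟩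
    have : T2Space W := hN.t2Space
    have hB : LieCalculus.HasCommonCharts ℬ := by
      rcases h with h | ⟨hF, hinv, _, hmax⟩
      · exact h
      · exact LieCalculus.IsMaximalAtlas.hasCommonCharts hK hF hinv hN hmax
    exact LieCalculus.exists_vertexMap hK hM hN hB hf
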